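/- A \emph{plane tree} is a finite tree drawn on the oriented sphere (equivalently, a map on the sphere with a single face), considered up to orientation-preserving homeomorphism. A \emph{leaf} is a vertex of degree $1$; a plane tree is \emph{leaf-rooted} if one of its leaves is distinguished as the root. (Equivalently, a leaf-rooted plane tree is a rooted plane tree with linearly ordered subtrees at every vertex, whose root has exactly one child.) For a set $S$ of positive integers, a tree is \emph{$S$-valent} if the degree of each of its vertices belongs to $S$. Let $\Delta$ be a nonempty, finite or infinite, set of integers $\delta\ge 3$, and let $p$ be the greatest common divisor of $\{\delta-2:\delta\in\Delta\}$. Let $T_\Delta(n)$ be the number of leaf-rooted $(\Delta\cup\{1\})$-valent plane trees with exactly $n$ non-root leaves. (a) The number of non-root leaves of every leaf-rooted $(\Delta\cup\{1\})$-valent plane tree is congruent to $1$ modulo $p$. (b) There are unique positive real numbers $\tau_\Delta,\rho_\Delta,\gamma_\Delta$ such that the following sums converge and $$\sum_{\delta\in\Delta}(\delta-1)\,\tau_\Delta^{\delta-2}=1,\qquad \rho_\Delta=\tau_\Delta-\sum_{\delta\in\Delta}\tau_\Delta^{\delta-1},\qquad \gamma_\Delta=\sqrt{\frac{2\rho_\Delta}{\sum_{\delta\in\Delta}(\delta-1)(\delta-2)\,\tau_\Delta^{\delta-3}}},$$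 and, as $n\to\infty$, $$T_\Delta(np+1)=\frac{p\,\gamma_\Delta}{2\sqrt{\pi}}\,(np+1)^{-3/2}\,\rho_\Delta^{-(np+1)}\left(1+O\!\left(n^{-1}\right)\right),$$ where the implied constant may depend on $\Delta$. -/

import Mathlib

/-- Rooted plane trees: a root vertex together with an ordered tuple of `k ≥ 0` rooted plane trees,
its subtrees listed from left to right. These are the finite trees drawn on the oriented sphere
(maps on the sphere with a single face), with a root-vertex and a first edge at the root-vertex,
up to homeomorphism. Every constructor `node` inside a term is one vertex of the tree. -/
inductive PlaneTree : Type where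
  | node : (k : ℕ) → (Fin k → PlaneTree) → PlaneTree

namespace PlaneTree

/-- The degree of the root-vertex. -/
def rootDegree : PlaneTree → ℕ
  | node k _ => k

/-- The multiset of the degrees of all vertices of a tree that hangs from one more edge, attached
to its root: a vertex with `k` children has degree `k + 1`. -/
def hangingDegrees : PlaneTree → Multiset ℕ
  | node k f => (k + 1) ::ₘ ∑ i, hangingDegrees (f i)

/-- The multiset of the degrees of all vertices other than the root-vertex. -/
def nonRootDegrees : PlaneTree → Multiset ℕ
  | node _ f => ∑ i, hangingDegrees (f i)

/-- The multiset of the degrees of all vertices. -/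
def degrees (t : PlaneTree) : Multiset ℕ :=
  t.rootDegree ::ₘ t.nonRootDegrees

/-- The degree of every vertex belongs to `S`. -/
def IsValent (S : Set ℕ) (t : PlaneTree) : Prop :=
  ∀ d ∈ t.degrees, d ∈ S

/-- The root-vertex is a leaf, that is, a vertex of degree one. -/
def IsLeafRooted (t : PlaneTree) : Prop :=
  t.rootDegree = 1

/-- The number of leaves other than the root-vertex. -/
def numNonRootLeaves (t : PlaneTree) : ℕ :=
  t.nonRootDegrees.count 1

/-- The set of leaf-rooted `(Δ ∪ {1})`-valent plane trees with `n` non-root leaves. -/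
def leafRootedTrees (Δ : Set ℕ) (n : ℕ) : Set PlaneTree :=
  {t | t.IsLeafRooted ∧ t.IsValent (Δ ∪ {1}) ∧ t.numNonRootLeaves = n}

/-- The number of leaf-rooted `(Δ ∪ {1})`-valent plane trees with `n` non-root leaves. -/
noncomputable def treeCount (Δ : Set ℕ) (n : ℕ) : ℕ :=
  (leafRootedTrees Δ n).ncard

/-- `τ`, `ρ`, `γ` are positive and satisfy `∑ (δ - 1) τ ^ (δ - 2) = 1`, `ρ = τ - ∑ τ ^ (δ - 1)` and
`γ = √(2 ρ / ∑ (δ - 1) (δ - 2) τ ^ (δ - 3))`, the sums being over `δ ∈ Δ` and convergent.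
(The exponents are natural numbers, and `Δ` is meant to have no element below three.) -/
structure IsTreeConstants (Δ : Set ℕ) (τ ρ γ : ℝ) : Prop where
  tau_pos : 0 < τ
  rho_pos : 0 < ρ
  gamma_pos : 0 < γ
  tau_eq : HasSum (fun δ : Δ => ((δ : ℝ) - 1) * τ ^ ((δ : ℕ) - 2)) 1
  rho_eq : ∃ s : ℝ, HasSum (fun δ : Δ => τ ^ ((δ : ℕ) - 1)) s ∧ ρ = τ - s
  gamma_eq : ∃ s : ℝ,
    HasSum (fun δ : Δ => ((δ : ℝ) - 1) * ((δ : ℝ) - 2) * τ ^ ((δ : ℕ) - 3)) s ∧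
      γ = √(2 * ρ / s)

end PlaneTree

/-! Deleting the root leaf leaves a hanging tree: a single leaf, or a vertex of degree `δ ∈ Δ` above
`δ - 1` hanging trees. Modulo `p` such a vertex does not change the number of leaves, since `δ - 1 ≡
1`; this is (a).

For (b), put `h(w) = ∑ w ^ (δ - 2)`. The generating function satisfies `T (1 - h(T)) = x`, so
Lagrange inversion predicts `[x ^ n] T ^ k = (k / n) [w ^ (n - k)] (1 - h) ^ (-n)`. This is
`mul_forestCount`, proved by a recursion that both sides obey: `forestCount_succ` removes the first
root of a forest, while `cauchyCoeff_eq_sub` and `mul_cauchyCoeff` are contour-integral identities.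

Write `S_k = ∑ (δ - 2) ^ k τ ^ (δ - 2)`. The equation for `τ` reads `S_0 + S_1 = 1`: it makes `τ`
the critical point of `w (1 - h(w))`, whose value there is `ρ = τ S_1`. On the circle `|w| = τ` the
integrand has `p` equal peaks, at the `p`-th roots of unity times `τ`. The parametrization `w = τ
exp(iθ / p)` merges them into one, and the integral becomes that of `A B ^ m` over `[-π, π]`, where
`B = 1 - b θ² / 2 + O(θ³)` and `|B| < 1` off `0` (`norm_peakFactor_lt`). Laplace's method
(`integral_mul_pow_sub_isBigO`) gives `√(2π / (b m))` with relative error `O(1 / m)`, and `γ = τ √(2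
/ (p b))` translates this into the stated form. -/

namespace PlaneTree

/-! ### Hanging trees and the congruence modulo `p` -/

/-- The number of leaves of a tree that hangs from one more edge, attached to its root. -/
def hangingLeaves (t : PlaneTree) : ℕ := t.hangingDegrees.count 1

/-- All vertices of the tree, hanging from one more edge, have degree in `Δ ∪ {1}`. -/
def IsHangingValent (Δ : Set ℕ) (t : PlaneTree) : Prop :=
  ∀ d ∈ t.hangingDegrees, d ∈ Δ ∪ {1}

theorem hangingLeaves_node (k : ℕ) (f : Fin k → PlaneTree) :
    (node k f).hangingLeaves = (if k = 0 then 1 else 0) + ∑ i, (f i).hangingLeaves := by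
  simp only [hangingLeaves, hangingDegrees, Multiset.count_cons, Multiset.count_sum']
  rw [add_comm]
  congr 1
  by_cases h : k = 0 <;> simp [h]

theorem isHangingValent_node {Δ : Set ℕ} (k : ℕ) (f : Fin k → PlaneTree) :
    (node k f).IsHangingValent Δ ↔ (k = 0 ∨ k + 1 ∈ Δ) ∧ ∀ i, (f i).IsHangingValent Δ := by
  simp only [IsHangingValent, hangingDegrees, Multiset.mem_cons, Multiset.mem_sum,
    Finset.mem_univ, true_and, forall_eq_or_imp, Set.mem_union, Set.mem_singleton_iff,
    Nat.add_eq_right]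
  constructor
  · rintro ⟨h1, h2⟩
    exact ⟨h1.symm, fun i d hd => h2 d ⟨i, hd⟩⟩
  · rintro ⟨h1, h2⟩
    exact ⟨h1.symm, fun d ⟨i, hd⟩ => h2 i d hd⟩

theorem hangingLeaves_pos (t : PlaneTree) : 0 < t.hangingLeaves := by
  induction t with
  | node k f ih =>
    rw [hangingLeaves_node]
    rcases Nat.eq_zero_or_pos k with h | h
    · simp [h]
    · have := Finset.single_le_sum (f := fun i => (f i).hangingLeaves)
        (fun i _ => Nat.zero_le _) (Finset.mem_univ (⟨0, h⟩ : Fin k))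
      have := ih ⟨0, h⟩
      omega

/-- Each of the `k` subtrees contributes `1` modulo `p`, and `k - 1 = δ - 2` is divisible by `p` at
a vertex of degree `δ = k + 1`. -/
theorem hangingLeaves_modEq {Δ : Set ℕ} (hΔ : ∀ δ ∈ Δ, 3 ≤ δ) {p : ℕ}
    (hp : ∀ δ ∈ Δ, p ∣ δ - 2) (t : PlaneTree) (ht : t.IsHangingValent Δ) :
    t.hangingLeaves ≡ 1 [MOD p] := by
  induction t with
  | node k f ih =>
    rw [isHangingValent_node] at ht
    rw [hangingLeaves_node]
    rcases ht.1 with rfl | hk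
    · simp [Nat.ModEq]
    · have h3 := hΔ _ hk
      have h1 : ∑ i, (f i).hangingLeaves ≡ ∑ i : Fin k, 1 [MOD p] :=
        Nat.ModEq.sum fun i _ => ih i (ht.2 i)
      rw [if_neg (by omega), zero_add]
      refine h1.trans ?_
      simp only [Finset.sum_const, Finset.card_univ, Fintype.card_fin, smul_eq_mul, mul_one]
      refine ((Nat.modEq_iff_dvd' (by omega)).2 ?_).symm
      have := hp _ hk
      rwa [show k + 1 - 2 = k - 1 by omega] at this

/-! ### Forests and the recursion for their number -/

/-- The forests of `k` hanging trees with all degrees in `Δ ∪ {1}` and `n` leaves in total. -/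
def forests (Δ : Set ℕ) (k n : ℕ) : Set (List PlaneTree) :=
  {l | l.length = k ∧ (∀ t ∈ l, t.IsHangingValent Δ) ∧ (l.map hangingLeaves).sum = n}

theorem treeCount_eq_ncard_forests (Δ : Set ℕ) (n : ℕ) :
    treeCount Δ n = (forests Δ 1 n).ncard := by
  symm
  refine Set.ncard_congr (fun l _ => node l.length l.get) ?_ ?_ ?_
  · rintro l ⟨h1, h2, h3⟩
    obtain ⟨t, rfl⟩ := List.length_eq_one_iff.1 h1
    refine ⟨rfl, ?_, ?_⟩
    · intro d hd
      simp only [degrees, nonRootDegrees, Multiset.mem_cons, rootDegree, Multiset.mem_sum,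
        Finset.mem_univ, true_and] at hd
      rcases hd with rfl | ⟨i, hi⟩
      · simp
      · exact h2 _ (List.get_mem _ _) d hi
    · simpa [numNonRootLeaves, nonRootDegrees, hangingLeaves, Fin.sum_univ_succ] using h3
  · intro l l' ⟨h1, _⟩ ⟨h2, _⟩ h
    obtain ⟨t, rfl⟩ := List.length_eq_one_iff.1 h1
    obtain ⟨t', rfl⟩ := List.length_eq_one_iff.1 h2
    simp only [List.length_cons, List.length_nil, node.injEq, heq_eq_eq, true_and] at h
    have := congrFun h 0
    simpa using this
  · rintro ⟨k, f⟩ ⟨h1, h2, h3⟩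
    obtain rfl : k = 1 := h1
    refine ⟨[f 0], ⟨rfl, ?_, ?_⟩, ?_⟩
    · intro t ht d hd
      obtain rfl := List.mem_singleton.1 ht
      refine h2 d ?_
      simp only [degrees, nonRootDegrees, Multiset.mem_cons, Multiset.mem_sum, Finset.mem_univ,
        true_and]
      exact Or.inr ⟨0, hd⟩
    · simpa [numNonRootLeaves, nonRootDegrees, hangingLeaves] using h3
    · simp only [List.length_cons, List.length_nil, node.injEq, heq_eq_eq, true_and]
      funext i
      fin_cases i
      rfl

theorem numNonRootLeaves_modEq {Δ : Set ℕ} (hΔ : ∀ δ ∈ Δ, 3 ≤ δ) {p : ℕ}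
    (hp : ∀ δ ∈ Δ, p ∣ δ - 2) (t : PlaneTree) (hr : t.IsLeafRooted)
    (ht : t.IsValent (Δ ∪ {1})) : t.numNonRootLeaves ≡ 1 [MOD p] := by
  obtain ⟨k, f⟩ := t
  obtain rfl : k = 1 := hr
  have : (node 1 f).numNonRootLeaves = (f 0).hangingLeaves := by
    simp [numNonRootLeaves, nonRootDegrees, hangingLeaves]
  rw [this]
  refine hangingLeaves_modEq hΔ hp _ fun d hd => ht d ?_
  simp only [degrees, nonRootDegrees, Multiset.mem_cons, Multiset.mem_sum, Finset.mem_univ,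
    true_and]
  exact Or.inr ⟨0, hd⟩

theorem length_le_sum_hangingLeaves (l : List PlaneTree) :
    l.length ≤ (l.map hangingLeaves).sum := by
  induction l with
  | nil => simp
  | cons t l ih =>
    have := t.hangingLeaves_pos
    simp only [List.length_cons, List.map_cons, List.sum_cons]
    omega

theorem forests_eq_empty {Δ : Set ℕ} {k n : ℕ} (h : n < k) : forests Δ k n = ∅ := by
  ext l
  simp only [forests, Set.mem_ofPred_eq, Set.mem_empty_iff_false, iff_false, not_and]
  rintro h1 - h3
  have := length_le_sum_hangingLeaves l
  omega

theorem forests_zero_zero (Δ : Set ℕ) : forests Δ 0 0 = {[]} := by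
  ext l
  simp only [forests, Set.mem_ofPred_eq, List.length_eq_zero_iff, Set.mem_singleton_iff]
  constructor
  · exact fun h => h.1
  · rintro rfl
    simp

theorem forests_zero_succ (Δ : Set ℕ) (n : ℕ) : forests Δ 0 (n + 1) = ∅ := by
  ext l
  simp only [forests, Set.mem_ofPred_eq, List.length_eq_zero_iff, Set.mem_empty_iff_false,
    iff_false]
  rintro ⟨rfl, -, h⟩
  simp at h

/-- Joins the first `j` trees of a forest at a new root. -/
def graft (j : ℕ) (l : List PlaneTree) : List PlaneTree :=
  node (l.take j).length (l.take j).get :: l.drop j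

theorem graft_injOn (j : ℕ) : {l : List PlaneTree | j ≤ l.length}.InjOn (graft j) := by
  intro l hl l' hl' h
  simp only [graft, List.cons.injEq, node.injEq] at h
  obtain ⟨⟨h1, h2⟩, h3⟩ := h
  have : l.take j = l'.take j := by
    refine List.ext_get h1 fun n hn hn' => ?_
    have := (Fin.heq_fun_iff h1).1 h2 ⟨n, hn⟩
    exact this
  rw [← List.take_append_drop j l, this, h3, List.take_append_drop]

theorem sum_ofFn_get (l : List PlaneTree) :
    ∑ i, (l.get i).hangingLeaves = (l.map hangingLeaves).sum := by
  rw [← Fin.sum_univ_fun_getElem]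
  rfl

open Classical in
-- Delete the root of the first tree. If it was a leaf, one tree and one leaf are lost; otherwise
-- its `δ - 1` subtrees join the forest and no leaf is lost. As every tree has a leaf, a forest has
-- at most `n + 1` trees, so the finite range of `δ` loses nothing.
theorem forests_succ {Δ : Set ℕ} (hΔ : ∀ δ ∈ Δ, 3 ≤ δ) (k n : ℕ) :
    forests Δ (k + 1) (n + 1) = graft 0 '' forests Δ k n ∪
      ⋃ δ ∈ (Finset.range (n + 4)).subtype (· ∈ Δ),
        graft (δ - 1) '' forests Δ (k + ((δ : ℕ) - 1)) (n + 1) := by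
  ext l
  simp only [Set.mem_union, Set.mem_iUnion, Set.mem_image, exists_prop]
  constructor
  · rintro ⟨h1, h2, h3⟩
    obtain _ | ⟨⟨j, f⟩, l⟩ := l
    · simp at h1
    · have hv := (isHangingValent_node j f).1 (h2 _ (by simp))
      simp only [List.map_cons, List.sum_cons, hangingLeaves_node, List.length_cons] at h3 h1
      rcases Nat.eq_zero_or_pos j with rfl | hj
      · left
        refine ⟨l, ⟨by omega, fun t ht => h2 t (by simp [ht]), ?_⟩, ?_⟩
        · simp at h3
          omega
        · simp only [graft, List.take_zero, List.length_nil, List.drop_zero, List.cons.injEq,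
            node.injEq, heq_eq_eq, true_and, and_true]
          funext i
          exact i.elim0
      · right
        have hjΔ := hv.1.resolve_left hj.ne'
        rw [if_neg hj.ne', zero_add] at h3
        have hs : ((List.ofFn f ++ l).map hangingLeaves).sum = n + 1 := by
          rw [List.map_append, List.sum_append, List.map_ofFn, List.sum_ofFn]
          exact h3
        have hlen := length_le_sum_hangingLeaves (List.ofFn f ++ l)
        rw [hs, List.length_append, List.length_ofFn] at hlen
        refine ⟨⟨j + 1, hjΔ⟩, ?_, List.ofFn f ++ l, ⟨?_, ?_, hs⟩, ?_⟩
        · simp only [Finset.mem_subtype, Finset.mem_range]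
          omega
        · simp only [List.length_append, List.length_ofFn]
          omega
        · intro t ht
          rcases List.mem_append.1 ht with h | h
          · obtain ⟨i, rfl⟩ := (List.mem_ofFn' f t).1 h
            exact hv.2 i
          · exact h2 t (by simp [h])
        · have e1 : (List.ofFn f ++ l).take (j + 1 - 1) = List.ofFn f := by
            rw [Nat.add_sub_cancel, List.take_left' (List.length_ofFn)]
          have e2 : (List.ofFn f ++ l).drop (j + 1 - 1) = l := by
            rw [Nat.add_sub_cancel, List.drop_left' (List.length_ofFn)]
          rw [graft, e1, e2]
          simp only [List.cons.injEq, and_true, node.injEq, List.length_ofFn, true_and]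
          refine (Fin.heq_fun_iff List.length_ofFn).2 fun i => ?_
          simp
  · rintro (⟨l, ⟨h1, h2, h3⟩, rfl⟩ | ⟨⟨δ, hδ⟩, -, l, ⟨h1, h2, h3⟩, rfl⟩)
    · refine ⟨by simp [graft, h1], ?_, ?_⟩
      · intro t ht
        rcases List.mem_cons.1 ht with rfl | h
        · rw [isHangingValent_node]
          exact ⟨Or.inl rfl, fun i => i.elim0⟩
        · exact h2 t (by simpa using h)
      · simp only [graft, List.map_cons, List.sum_cons, hangingLeaves_node, sum_ofFn_get]
        simp [h3, add_comm]
    · have h4 := hΔ δ hδ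
      simp only at h1
      have h5 : (l.take (δ - 1)).length = δ - 1 := by
        rw [List.length_take]
        omega
      refine ⟨?_, ?_, ?_⟩
      · simp only [graft, List.length_cons, List.length_drop]
        omega
      · intro t ht
        rcases List.mem_cons.1 ht with rfl | h
        · rw [isHangingValent_node]
          refine ⟨Or.inr ?_, fun i => h2 _ (List.mem_of_mem_take (List.get_mem _ i))⟩
          rw [h5, Nat.sub_add_cancel (by omega)]
          exact hδ
        · exact h2 t (List.mem_of_mem_drop h)
      · simp only [graft, List.map_cons, List.sum_cons, hangingLeaves_node, sum_ofFn_get]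
        rw [if_neg (by omega), zero_add, ← List.sum_append, ← List.map_append,
          List.take_append_drop, h3]

/-- Each term of the recursion has either fewer leaves or, for the same number of leaves, more
trees; there are no forests with more trees than leaves. Hence the inner induction on `n + 1 - k`.
-/
theorem finite_forests {Δ : Set ℕ} (hΔ : ∀ δ ∈ Δ, 3 ≤ δ) (k n : ℕ) : (forests Δ k n).Finite := by
  induction n generalizing k with
  | zero =>
    rcases k with _ | k
    · simp [forests_zero_zero]
    · simp [forests_eq_empty (Nat.succ_pos k)]
  | succ n ihn =>
    by_cases hk : n + 1 < k
    · simp [forests_eq_empty hk]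
    · obtain ⟨d, hd⟩ : ∃ d, d = n + 1 - k := ⟨_, rfl⟩
      induction d using Nat.strong_induction_on generalizing k with
      | _ d ih =>
        rcases k with _ | k
        · simp [forests_zero_succ]
        · rw [forests_succ hΔ]
          refine ((ihn k).image _).union (Set.Finite.biUnion (Finset.finite_toSet _) ?_)
          rintro ⟨δ, hδ⟩ -
          have h3 := hΔ δ hδ
          refine Set.Finite.image _ ?_
          by_cases hk' : n + 1 < k + (δ - 1)
          · simp [forests_eq_empty hk']
          · exact ih (n + 1 - (k + (δ - 1))) (by omega) _ hk' rfl

/-- The number of forests of `k` hanging trees with `n` leaves. -/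
noncomputable def forestCount (Δ : Set ℕ) (k n : ℕ) : ℕ := (forests Δ k n).ncard

open Classical in
theorem forestCount_succ {Δ : Set ℕ} (hΔ : ∀ δ ∈ Δ, 3 ≤ δ) (k n : ℕ) :
    forestCount Δ (k + 1) (n + 1) = forestCount Δ k n +
      ∑ δ ∈ (Finset.range (n + 4)).subtype (· ∈ Δ),
        forestCount Δ (k + ((δ : ℕ) - 1)) (n + 1) := by
  -- The first root has `j` children, so grafts with different `j` are different and the union in
  -- `forests_succ` is disjoint.
  have hroot : ∀ {j j' : ℕ} {l l' : List PlaneTree}, j ≤ l.length → j' ≤ l'.length →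
      graft j l = graft j' l' → j = j' := by
    intro j j' l l' h h' e
    simp only [graft, List.cons.injEq, node.injEq, List.length_take] at e
    omega
  have hfin : ∀ j k n, (graft j '' forests Δ k n).Finite := fun j k n =>
    (finite_forests hΔ k n).image _
  have hcard : ∀ j k n, j ≤ k → (graft j '' forests Δ k n).ncard = forestCount Δ k n := by
    intro j k n h
    refine Set.InjOn.ncard_image ((graft_injOn j).mono ?_)
    rintro l ⟨rfl, -⟩
    exact h
  have hbfin : ∀ δ ∈ ((Finset.range (n + 4)).subtype (· ∈ Δ) : Set Δ),
      (graft (δ - 1) '' forests Δ (k + ((δ : ℕ) - 1)) (n + 1)).Finite := fun δ _ => hfin _ _ _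
  have hU := (Finset.finite_toSet ((Finset.range (n + 4)).subtype (· ∈ Δ))).ncard_biUnion hbfin ?_
  · have hbu := Set.Finite.biUnion (Finset.finite_toSet _) hbfin
    simp only [SetLike.mem_coe] at hU hbu
    rw [forestCount, forests_succ hΔ, Set.ncard_union_eq ?_ (hfin _ _ _) hbu, hcard _ _ _ (Nat.zero_le k)]
    · congr 1
      refine hU.trans ?_
      rw [finsum_mem_finset_eq_sum]
      exact Finset.sum_congr rfl fun δ _ => hcard _ _ _ (by omega)
    · rw [Set.disjoint_left]
      rintro _ ⟨l, ⟨hl, -⟩, rfl⟩ h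
      simp only [Set.mem_iUnion, Set.mem_image, exists_prop] at h
      obtain ⟨⟨δ, hδ⟩, -, l', ⟨hl', -⟩, h⟩ := h
      have := hroot (by simp only at hl' ⊢; omega) (Nat.zero_le _) h
      have := hΔ δ hδ
      simp only at *
      omega
  · rintro ⟨δ, hδ⟩ - ⟨δ', hδ'⟩ - hne
    refine Set.disjoint_left.2 ?_
    rintro _ ⟨l, ⟨hl, -⟩, rfl⟩ ⟨l', ⟨hl', -⟩, h⟩
    have := hroot (by simp only at hl' ⊢; omega) (by simp only at hl ⊢; omega) h
    have := hΔ δ hδ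
    have := hΔ δ' hδ'
    refine hne (Subtype.ext ?_)
    simp only at *
    omega

end PlaneTree

/-! ### Laplace's method with error term -/

/-- The second-order remainders satisfy `R (k + 1) = x * R k + (k + 2) * y ^ (k + 1) * (x - y) ^ 2`,
which yields the bound by induction; the square is a crude substitute for the binomial coefficient.
-/
theorem norm_pow_sub_pow_sub_mul_le {x y : ℂ} {M : ℝ} (hx : ‖x‖ ≤ M) (hy : ‖y‖ ≤ M) (k : ℕ) :
    ‖x ^ (k + 2) - y ^ (k + 2) - (k + 2) * y ^ (k + 1) * (x - y)‖ ≤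
      ((k : ℝ) + 2) ^ 2 * ‖x - y‖ ^ 2 * M ^ k := by
  have hM : 0 ≤ M := (norm_nonneg _).trans hx
  induction k with
  | zero =>
    have : x ^ (0 + 2) - y ^ (0 + 2) - ((0 : ℕ) + 2) * y ^ (0 + 1) * (x - y) = (x - y) ^ 2 := by
      push_cast
      ring
    rw [this, norm_pow]
    simp only [CharP.cast_eq_zero, pow_zero, mul_one]
    nlinarith [sq_nonneg ‖x - y‖]
  | succ k ih =>
    have : x ^ (k + 1 + 2) - y ^ (k + 1 + 2) - ((k + 1 : ℕ) + 2) * y ^ (k + 1 + 1) * (x - y) =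
        x * (x ^ (k + 2) - y ^ (k + 2) - (k + 2) * y ^ (k + 1) * (x - y)) +
          (k + 2) * y ^ (k + 1) * (x - y) ^ 2 := by
      push_cast
      ring
    rw [this]
    have h2 : ‖((k : ℂ) + 2)‖ = (k : ℝ) + 2 := by
      have : ((k : ℂ) + 2) = (((k : ℝ) + 2 : ℝ) : ℂ) := by push_cast; ring
      rw [this, Complex.norm_real, Real.norm_of_nonneg (by positivity)]
    calc _ ≤ ‖x‖ * ‖x ^ (k + 2) - y ^ (k + 2) - (k + 2) * y ^ (k + 1) * (x - y)‖ +
          (k + 2) * ‖y‖ ^ (k + 1) * ‖x - y‖ ^ 2 := by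
          refine (norm_add_le _ _).trans_eq ?_
          simp only [norm_mul, norm_pow, h2]
      _ ≤ M * (((k : ℝ) + 2) ^ 2 * ‖x - y‖ ^ 2 * M ^ k) +
          (k + 2) * M ^ (k + 1) * ‖x - y‖ ^ 2 := by gcongr
      _ ≤ _ := by
        have : 0 ≤ M ^ (k + 1) * ‖x - y‖ ^ 2 * ((k : ℝ) + 3) := by positivity
        push_cast
        have e : M * (((k : ℝ) + 2) ^ 2 * ‖x - y‖ ^ 2 * M ^ k) =
          M ^ (k + 1) * ‖x - y‖ ^ 2 * ((k : ℝ) + 2) ^ 2 := by ring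
        nlinarith

/-- With `t = m θ²`, this trades the polynomial factors of the error term for a part of the Gaussian
decay. -/
theorem exists_poly_le_exp {κ : ℝ} (hκ : 0 < κ) :
    ∃ K : ℝ, 0 < K ∧ ∀ t : ℝ, 0 ≤ t → t + t ^ 2 + t ^ 3 ≤ K * Real.exp (κ * t) := by
  refine ⟨1 / κ + 2 / κ ^ 2 + 6 / κ ^ 3, by positivity, fun t ht => ?_⟩
  have h (n : ℕ) : t ^ n ≤ n.factorial / κ ^ n * Real.exp (κ * t) := by
    have h0 := Real.pow_div_factorial_le_exp (κ * t) (by positivity) n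
    rw [div_le_iff₀ (by positivity), mul_pow] at h0
    rw [div_mul_eq_mul_div, le_div_iff₀ (by positivity)]
    linarith
  have h1 := h 1
  have h2 := h 2
  have h3 := h 3
  simp only [Nat.factorial, pow_one] at h1 h2 h3
  norm_num at h1 h2 h3
  rw [add_mul, add_mul, one_div]
  linarith

theorem abs_exp_neg_sub_le {t : ℝ} (ht : 0 ≤ t) : |Real.exp (-t) - (1 - t)| ≤ t ^ 2 := by
  have h1 := Real.add_one_le_exp (-t)
  rw [abs_of_nonneg (by linarith)]
  rcases le_total t 1 with h | h
  · have := Real.norm_exp_sub_one_sub_id_le (x := -t) (by rwa [norm_neg, Real.norm_of_nonneg ht])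
    rw [Real.norm_eq_abs, norm_neg, Real.norm_eq_abs, sq_abs] at this
    have := (abs_le.1 this).2
    linarith
  · have : Real.exp (-t) ≤ 1 := Real.exp_le_one_iff.2 (by linarith)
    nlinarith

open Filter Topology Asymptotics MeasureTheory Set in
/-- On a compact interval, a local bound at `0` by a power of the variable is global. -/
theorem exists_norm_le_pow_of_isBigO {f : ℝ → ℂ} (hf : Continuous f) {k : ℕ}
    (h : f =O[𝓝 0] fun θ : ℝ => θ ^ k) (r : ℝ) :
    ∃ C : ℝ, 0 < C ∧ ∀ θ ∈ Icc (-r) r, ‖f θ‖ ≤ C * |θ| ^ k := by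
  obtain ⟨C, hC⟩ := h.bound
  obtain ⟨η, hη, hC⟩ := Metric.eventually_nhds_iff.1 hC
  obtain ⟨D, hD⟩ := (isCompact_Icc (a := -r) (b := r)).exists_bound_of_continuousOn hf.continuousOn
  refine ⟨max 1 (max C (D / η ^ k)), by positivity, fun θ hθ => ?_⟩
  by_cases h : |θ| < η
  · have := hC (y := θ) (by simpa [Real.dist_eq] using h)
    rw [norm_pow, Real.norm_eq_abs] at this
    refine this.trans ?_
    gcongr
    exact (le_max_left _ _).trans (le_max_right _ _)
  · have h0 : 0 ≤ D := (norm_nonneg _).trans (hD θ hθ)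
    calc ‖f θ‖ ≤ D := hD θ hθ
      _ = D / η ^ k * η ^ k := by field_simp
      _ ≤ max 1 (max C (D / η ^ k)) * |θ| ^ k := by
        push Not at h
        gcongr
        exact (le_max_right _ _).trans (le_max_right _ _)

open Filter Topology Asymptotics MeasureTheory Set in
-- Near `0` the quadratic term dominates the cubic and quartic ones; away from `0` compactness gives
-- `‖B θ‖ ≤ q < 1`. Both bounds lie below `1 - κ θ²` for small `κ`.
theorem exists_norm_le_exp_neg_sq {B : ℝ → ℂ} (hB : Continuous B) {b : ℝ} (hb : 0 < b) {c : ℂ}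
    (hB1 : (fun θ : ℝ => B θ - (1 - b / 2 * θ ^ 2 + c * θ ^ 3)) =O[𝓝 0] fun θ : ℝ => θ ^ 4)
    {r : ℝ} (hr : 0 < r) (hlt : ∀ θ ∈ Icc (-r) r, θ ≠ 0 → ‖B θ‖ < 1) :
    ∃ κ : ℝ, 0 < κ ∧ κ ≤ b / 2 ∧ ∀ θ ∈ Icc (-r) r, ‖B θ‖ ≤ Real.exp (-(κ * θ ^ 2)) := by
  obtain ⟨C, hC0, hC⟩ := exists_norm_le_pow_of_isBigO (by fun_prop) hB1 r
  -- near zero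
  obtain ⟨η, hη, hη1, hηr, hηb⟩ : ∃ η : ℝ, 0 < η ∧ η ≤ 1 ∧ η ≤ r ∧
      b / 2 * η ^ 2 ≤ 1 ∧ (‖c‖ + C) * η ≤ b / 4 := by
    refine ⟨min 1 (min r (min (1 / b) (b / 4 / (‖c‖ + C)))), by positivity, min_le_left _ _,
      (min_le_right _ _).trans (min_le_left _ _), ?_, ?_⟩
    · set η := min 1 (min r (min (1 / b) (b / 4 / (‖c‖ + C)))) with hη
      have h0 : 0 < η := by positivity
      have h1 : η ≤ 1 := min_le_left _ _
      have h2 : η ≤ 1 / b :=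
        ((min_le_right _ _).trans (min_le_right _ _)).trans (min_le_left _ _)
      have h3 : b * η ≤ 1 := by
        rw [le_div_iff₀ hb] at h2
        linarith
      nlinarith
    · rw [mul_comm, ← le_div_iff₀ (by positivity)]
      exact ((min_le_right _ _).trans (min_le_right _ _)).trans (min_le_right _ _)
  have hnear : ∀ θ : ℝ, |θ| ≤ η → ‖B θ‖ ≤ 1 - b / 4 * θ ^ 2 := by
    intro θ hθ
    have h1 := hC θ (abs_le.1 (hθ.trans hηr))
    have h2 : ‖(1 - b / 2 * θ ^ 2 : ℂ)‖ = 1 - b / 2 * θ ^ 2 := by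
      have : (1 - b / 2 * θ ^ 2 : ℂ) = ((1 - b / 2 * θ ^ 2 : ℝ) : ℂ) := by push_cast; ring
      rw [this, Complex.norm_real, Real.norm_of_nonneg]
      have : θ ^ 2 ≤ η ^ 2 := sq_le_sq' (by linarith [abs_le.1 hθ]) (abs_le.1 hθ).2
      nlinarith [hηb.1]
    calc ‖B θ‖ = ‖(B θ - (1 - b / 2 * θ ^ 2 + c * θ ^ 3)) + (1 - b / 2 * θ ^ 2) + c * θ ^ 3‖ := by
          congr 1; ring
      _ ≤ C * |θ| ^ 4 + (1 - b / 2 * θ ^ 2) + ‖c‖ * |θ| ^ 3 := by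
        refine (norm_add₃_le).trans ?_
        rw [h2, norm_mul, norm_pow, Complex.norm_real, Real.norm_eq_abs]
        gcongr
      _ ≤ _ := by
        have e : |θ| ^ 2 = θ ^ 2 := sq_abs θ
        have h3 : C * |θ| ^ 4 + ‖c‖ * |θ| ^ 3 ≤ (‖c‖ + C) * η * |θ| ^ 2 := by
          calc C * |θ| ^ 4 + ‖c‖ * |θ| ^ 3 = (C * |θ| + ‖c‖) * |θ| * |θ| ^ 2 := by ring
            _ ≤ (C * 1 + ‖c‖) * η * |θ| ^ 2 := by gcongr; linarith
            _ = _ := by ring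
        have h4 : (‖c‖ + C) * η * |θ| ^ 2 ≤ b / 4 * |θ| ^ 2 := by
          gcongr
          exact hηb.2
        rw [e] at h3 h4
        linarith
  -- away from zero
  obtain ⟨q, hq1, hq⟩ : ∃ q : ℝ, q < 1 ∧ ∀ θ ∈ Icc (-r) r, η ≤ |θ| → ‖B θ‖ ≤ q := by
    have hc : IsCompact (Icc (-r) r ∩ {θ : ℝ | η ≤ |θ|}) :=
      isCompact_Icc.inter_right (isClosed_le continuous_const continuous_abs)
    have hne : (Icc (-r) r ∩ {θ : ℝ | η ≤ |θ|}).Nonempty :=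
      ⟨r, ⟨by linarith, le_rfl⟩, by rw [mem_ofPred_eq, abs_of_pos hr]; exact hηr⟩
    obtain ⟨x, hx, hmax⟩ := hc.exists_isMaxOn hne hB.norm.continuousOn
    refine ⟨‖B x‖, hlt x hx.1 ?_, fun θ h1 h2 => hmax ⟨h1, h2⟩⟩
    rintro rfl
    have := hx.2
    rw [mem_ofPred_eq, abs_zero] at this
    linarith
  refine ⟨min (b / 4) ((1 - q) / r ^ 2), lt_min (by positivity)
    (div_pos (by linarith) (by positivity)), (min_le_left _ _).trans (by linarith),
    fun θ hθ => ?_⟩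
  have h1 : 1 - min (b / 4) ((1 - q) / r ^ 2) * θ ^ 2 ≤
      Real.exp (-(min (b / 4) ((1 - q) / r ^ 2) * θ ^ 2)) := Real.one_sub_le_exp_neg _
  refine le_trans ?_ h1
  rcases le_total (|θ|) η with h | h
  · have : min (b / 4) ((1 - q) / r ^ 2) * θ ^ 2 ≤ b / 4 * θ ^ 2 := by
      gcongr
      exact min_le_left _ _
    linarith [hnear θ h]
  · have h3 : min (b / 4) ((1 - q) / r ^ 2) * θ ^ 2 ≤ (1 - q) / r ^ 2 * r ^ 2 := by
      have : θ ^ 2 ≤ r ^ 2 := sq_le_sq' hθ.1 hθ.2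
      have h4 : 0 < 1 - q := by linarith
      gcongr
      exact min_le_right _ _
    rw [div_mul_cancel₀ _ (by positivity)] at h3
    linarith [hq θ hθ h]

open Filter Topology Asymptotics MeasureTheory Set in
/-- Laplace's method for a complex integrand: the pointwise comparison with a Gaussian. -/
theorem exists_norm_mul_pow_sub_le {A B : ℝ → ℂ} (hA : Continuous A) (hB : Continuous B)
    {b : ℝ} (hb : 0 < b) {a c : ℂ}
    (hA1 : (fun θ : ℝ => A θ - 1 - a * θ) =O[𝓝 0] fun θ : ℝ => θ ^ 2)
    (hB1 : (fun θ : ℝ => B θ - (1 - b / 2 * θ ^ 2 + c * θ ^ 3)) =O[𝓝 0] fun θ : ℝ => θ ^ 4)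
    {r : ℝ} (hr : 0 < r) (hlt : ∀ θ ∈ Icc (-r) r, θ ≠ 0 → ‖B θ‖ < 1) :
    ∃ κ K : ℝ, 0 < κ ∧ κ ≤ b / 2 ∧ 0 < K ∧ ∀ m : ℕ, 4 ≤ m → ∀ θ ∈ Icc (-r) r,
      ‖A θ * B θ ^ m - (Real.exp (-(b / 2 * θ ^ 2)) ^ m +
        (a * θ * Real.exp (-(b / 2 * θ ^ 2)) ^ m +
          m * c * θ ^ 3 * Real.exp (-(b / 2 * θ ^ 2)) ^ (m - 1)))‖ ≤
      K * (θ ^ 2 + m * θ ^ 4 + m ^ 2 * θ ^ 6) * Real.exp (-(κ * (m * θ ^ 2))) := by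
  obtain ⟨κ, hκ, hκb, hκB⟩ := exists_norm_le_exp_neg_sq hB hb hB1 hr hlt
  obtain ⟨C₁, hC₁0, hC₁⟩ := exists_norm_le_pow_of_isBigO (by fun_prop) hA1 r
  obtain ⟨C₂, hC₂0, hC₂⟩ := exists_norm_le_pow_of_isBigO (by fun_prop) hB1 r
  set C₃ := C₂ + b ^ 2 / 4 with hC₃
  have hC₃0 : 0 < C₃ := by positivity
  set C₄ := ‖c‖ + C₃ * r with hC₄
  have hC₄0 : 0 ≤ C₄ := by positivity
  set L := 1 + ‖a‖ * r with hL
  have hL0 : 0 ≤ L := by positivity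
  -- The rate is halved because only the power `m - 2` of the bound on `B` is at hand, and `m - 2 ≥
  -- m / 2` for `m ≥ 4`. The three constants belong to the three groups of terms in `hsplit`.
  refine ⟨κ / 2, C₁ + L * C₄ ^ 2 + (L * C₃ + ‖a‖ * ‖c‖), by positivity, by linarith,
    by positivity, fun m hm θ hθ => ?_⟩
  have hθr : |θ| ≤ r := abs_le.2 hθ
  set G : ℝ := Real.exp (-(b / 2 * θ ^ 2)) with hG
  set M : ℝ := Real.exp (-(κ * θ ^ 2)) with hM
  have hM0 : 0 < M := Real.exp_pos _
  have hM1 : M ≤ 1 := Real.exp_le_one_iff.2 (by nlinarith [mul_nonneg hκ.le (sq_nonneg θ)])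
  have hG0 : 0 < G := Real.exp_pos _
  have hGM : G ≤ M := Real.exp_le_exp.2 (by nlinarith [sq_nonneg θ])
  have hGn : ‖(G : ℂ)‖ = G := by rw [Complex.norm_real, Real.norm_of_nonneg hG0.le]
  have habs : (|θ| ^ 2 = θ ^ 2) ∧ (|θ| ^ 4 = θ ^ 4) ∧ (|θ| ^ 6 = θ ^ 6) :=
    ⟨sq_abs θ, Even.pow_abs (by decide) θ, Even.pow_abs (by decide) θ⟩
  obtain ⟨D, hD⟩ : ∃ D : ℂ, D = B θ - G - c * θ ^ 3 := ⟨_, rfl⟩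
  have hDn : ‖D‖ ≤ C₃ * |θ| ^ 4 := by
    have h1 : D = (B θ - (1 - b / 2 * θ ^ 2 + c * θ ^ 3)) -
        ((G - (1 - b / 2 * θ ^ 2) : ℝ) : ℂ) := by
      rw [hD]
      push_cast
      ring
    rw [h1]
    refine (norm_sub_le _ _).trans ?_
    rw [Complex.norm_real, Real.norm_eq_abs, hC₃, add_mul]
    refine add_le_add (hC₂ θ hθ) ((abs_exp_neg_sub_le (by positivity)).trans_eq ?_)
    rw [habs.2.1]
    ring
  have hBG : ‖B θ - G‖ ≤ C₄ * |θ| ^ 3 := by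
    have h1 : B θ - G = D + c * θ ^ 3 := by rw [hD]; ring
    rw [h1]
    refine (norm_add_le _ _).trans ?_
    rw [norm_mul, norm_pow, Complex.norm_real, Real.norm_eq_abs, hC₄, add_mul, add_comm]
    gcongr
    calc ‖D‖ ≤ C₃ * |θ| ^ 4 := hDn
      _ = C₃ * |θ| * |θ| ^ 3 := by ring
      _ ≤ C₃ * r * |θ| ^ 3 := by gcongr
  have hL1 : ‖1 + a * (θ : ℂ)‖ ≤ L := by
    refine (norm_add_le _ _).trans ?_
    rw [norm_one, norm_mul, Complex.norm_real, Real.norm_eq_abs, hL]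
    gcongr
  obtain ⟨k, rfl⟩ : ∃ k, m = k + 2 := ⟨m - 2, by omega⟩
  have hpow := norm_pow_sub_pow_sub_mul_le (hκB θ hθ) (hGn.le.trans hGM) k
  have hk1 : k + 2 - 1 = k + 1 := rfl
  rw [hk1]
  -- The groups are: the remainder of `A`; the second-order remainder of the power at `G`; and the
  -- first-order term with `B - G = D + c θ³`, minus the odd part `m c θ³ G ^ (m - 1)`.
  have hsplit : A θ * B θ ^ (k + 2) - ((G : ℂ) ^ (k + 2) +
        (a * θ * (G : ℂ) ^ (k + 2) + (k + 2 : ℕ) * c * θ ^ 3 * (G : ℂ) ^ (k + 1))) =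
      (A θ - 1 - a * θ) * B θ ^ (k + 2) +
      (1 + a * θ) * (B θ ^ (k + 2) - (G : ℂ) ^ (k + 2) -
        (k + 2) * (G : ℂ) ^ (k + 1) * (B θ - G)) +
      ((1 + a * θ) * (((k : ℂ) + 2) * (G : ℂ) ^ (k + 1) * D) +
        a * θ * (((k : ℂ) + 2) * (G : ℂ) ^ (k + 1) * (c * θ ^ 3))) := by
    rw [hD]
    push_cast
    ring
  have hkn : ‖(k : ℂ) + 2‖ = (k : ℝ) + 2 := by
    have : ((k : ℂ) + 2) = (((k : ℝ) + 2 : ℝ) : ℂ) := by push_cast; ring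
    rw [this, Complex.norm_real, Real.norm_of_nonneg (by positivity)]
  have hMk : M ^ (k + 2) ≤ M ^ k := pow_le_pow_of_le_one hM0.le hM1 (by omega)
  have hGk : G ^ (k + 1) ≤ M ^ k :=
    (pow_le_pow_left₀ hG0.le hGM _).trans (pow_le_pow_of_le_one hM0.le hM1 (by omega))
  have hMe : M ^ k ≤ Real.exp (-(κ / 2 * (((k + 2 : ℕ) : ℝ) * θ ^ 2))) := by
    rw [hM, ← Real.exp_nat_mul]
    refine Real.exp_le_exp.2 ?_
    have : (2 : ℝ) ≤ k := by exact_mod_cast (by omega : 2 ≤ k)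
    push_cast
    have h2 : 0 ≤ κ * θ ^ 2 := by positivity
    nlinarith
  rw [hsplit]
  have t1 : ‖(A θ - 1 - a * θ) * B θ ^ (k + 2)‖ ≤ C₁ * θ ^ 2 * M ^ k := by
    rw [norm_mul, norm_pow, ← habs.1]
    gcongr
    · exact hC₁ θ hθ
    · exact (pow_le_pow_left₀ (norm_nonneg _) (hκB θ hθ) _).trans hMk
  have t2 : ‖(1 + a * θ) * (B θ ^ (k + 2) - (G : ℂ) ^ (k + 2) -
        (k + 2) * (G : ℂ) ^ (k + 1) * (B θ - G))‖ ≤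
      L * C₄ ^ 2 * ((k + 2 : ℝ) ^ 2 * θ ^ 6) * M ^ k := by
    rw [norm_mul]
    calc _ ≤ L * (((k : ℝ) + 2) ^ 2 * (C₄ * |θ| ^ 3) ^ 2 * M ^ k) := by
          gcongr
          refine hpow.trans ?_
          gcongr
      _ = L * C₄ ^ 2 * ((k + 2 : ℝ) ^ 2 * |θ| ^ 6) * M ^ k := by ring
      _ = _ := by rw [habs.2.2]
  have t3 : ‖(1 + a * θ) * (((k : ℂ) + 2) * (G : ℂ) ^ (k + 1) * D)‖ ≤
      L * C₃ * ((k + 2 : ℝ) * θ ^ 4) * M ^ k := by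
    rw [norm_mul, norm_mul, norm_mul, hkn, norm_pow, hGn]
    calc _ ≤ L * (((k : ℝ) + 2) * M ^ k * (C₃ * |θ| ^ 4)) := by gcongr
      _ = L * C₃ * ((k + 2 : ℝ) * |θ| ^ 4) * M ^ k := by ring
      _ = _ := by rw [habs.2.1]
  have t4 : ‖a * θ * (((k : ℂ) + 2) * (G : ℂ) ^ (k + 1) * (c * θ ^ 3))‖ ≤
      ‖a‖ * ‖c‖ * ((k + 2 : ℝ) * θ ^ 4) * M ^ k := by
    simp only [norm_mul, hkn, norm_pow, hGn, Complex.norm_real, Real.norm_eq_abs]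
    calc _ ≤ ‖a‖ * |θ| * (((k : ℝ) + 2) * M ^ k * (‖c‖ * |θ| ^ 3)) := by gcongr
      _ = ‖a‖ * ‖c‖ * ((k + 2 : ℝ) * |θ| ^ 4) * M ^ k := by ring
      _ = _ := by rw [habs.2.1]
  have hP1 : 0 ≤ θ ^ 2 := sq_nonneg θ
  have hP2 : 0 ≤ (k + 2 : ℝ) * θ ^ 4 := by positivity
  have hP3 : 0 ≤ (k + 2 : ℝ) ^ 2 * θ ^ 6 := by positivity
  calc _ ≤ (C₁ * θ ^ 2 + L * C₄ ^ 2 * ((k + 2 : ℝ) ^ 2 * θ ^ 6) +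
        (L * C₃ + ‖a‖ * ‖c‖) * ((k + 2 : ℝ) * θ ^ 4)) * M ^ k := by
        refine (norm_add₃_le).trans ?_
        have := norm_add_le ((1 + a * θ) * (((k : ℂ) + 2) * (G : ℂ) ^ (k + 1) * D))
          (a * θ * (((k : ℂ) + 2) * (G : ℂ) ^ (k + 1) * (c * θ ^ 3)))
        linarith
    _ ≤ ((C₁ + L * C₄ ^ 2 + (L * C₃ + ‖a‖ * ‖c‖)) *
        (θ ^ 2 + (k + 2 : ℝ) * θ ^ 4 + (k + 2 : ℝ) ^ 2 * θ ^ 6)) * M ^ k := by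
      gcongr ?_ * _
      have q1 : 0 ≤ L * C₄ ^ 2 := by positivity
      have q2 : 0 ≤ L * C₃ + ‖a‖ * ‖c‖ := by positivity
      have aux : ∀ {x y z u v w : ℝ}, 0 ≤ x → 0 ≤ y → 0 ≤ z → 0 ≤ u → 0 ≤ v → 0 ≤ w →
          x * u + y * w + z * v ≤ (x + y + z) * (u + v + w) := by
        intro x y z u v w hx hy hz hu hv hw
        have : (x + y + z) * (u + v + w) - (x * u + y * w + z * v) =
          x * v + x * w + y * u + y * v + z * u + z * w := by ring
        have : 0 ≤ x * v + x * w + y * u + y * v + z * u + z * w := by positivity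
        linarith
      exact aux hC₁0.le q1 q2 hP1 hP2 hP3
    _ ≤ _ := by
      push_cast at hMe ⊢
      gcongr

theorem intervalIntegral_eq_zero_of_odd {f : ℝ → ℂ} (hf : ∀ x, f (-x) = -f x) (r : ℝ) :
    ∫ x in -r..r, f x = 0 := by
  have h := intervalIntegral.integral_comp_neg (a := -r) (b := r) f
  simp only [hf, intervalIntegral.integral_neg, neg_neg] at h
  exact self_eq_neg.1 h.symm

open Filter Topology Asymptotics MeasureTheory Set in
/-- Laplace's method for a complex integrand, with the relative error `O(1 / m)`. -/
theorem integral_mul_pow_sub_isBigO {A B : ℝ → ℂ} (hA : Continuous A) (hB : Continuous B)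
    {b : ℝ} (hb : 0 < b) {a c : ℂ}
    (hA1 : (fun θ : ℝ => A θ - 1 - a * θ) =O[𝓝 0] fun θ : ℝ => θ ^ 2)
    (hB1 : (fun θ : ℝ => B θ - (1 - b / 2 * θ ^ 2 + c * θ ^ 3)) =O[𝓝 0] fun θ : ℝ => θ ^ 4)
    {r : ℝ} (hr : 1 ≤ r) (hlt : ∀ θ ∈ Icc (-r) r, θ ≠ 0 → ‖B θ‖ < 1) :
    (fun m : ℕ => (∫ θ in -r..r, A θ * B θ ^ m) - (√(2 * Real.pi / (b * m)) : ℝ)) =O[atTop]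
      fun m : ℕ => 1 / ((m : ℝ) * √m) := by
  obtain ⟨κ, K, hκ, hκb, hK, hmain⟩ :=
    exists_norm_mul_pow_sub_le hA hB hb hA1 hB1 (by linarith) hlt
  obtain ⟨P, hP0, hP⟩ := exists_poly_le_exp (half_pos hκ)
  refine IsBigO.of_bound ((K + 1) * P * √(2 * Real.pi / κ)) ?_
  filter_upwards [eventually_ge_atTop 4] with m hm
  have hm0 : (0 : ℝ) < m := by exact_mod_cast (by omega : 0 < m)
  set G : ℝ → ℝ := fun θ => Real.exp (-(b / 2 * θ ^ 2)) with hG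
  set O : ℝ → ℂ := fun θ => a * θ * (G θ : ℂ) ^ m + m * c * θ ^ 3 * (G θ : ℂ) ^ (m - 1) with hO
  have hGc : Continuous G := by fun_prop
  have hOc : Continuous O := by fun_prop
  -- The corrections of relative order `m ^ (-1/2)` are odd and integrate to zero; this is what
  -- leaves a relative error of `1 / m`.
  have hO0 : ∫ θ in -r..r, O θ = 0 := by
    refine intervalIntegral_eq_zero_of_odd (fun x => ?_) r
    have : G (-x) = G x := by simp [hG]
    simp only [hO, this]
    push_cast
    ring
  have hGm : ∀ θ, G θ ^ m = Real.exp (-(b / 2 * m) * θ ^ 2) := by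
    intro θ
    rw [hG, ← Real.exp_nat_mul]
    congr 1
    ring
  have hGi : ∫ θ, ((G θ ^ m : ℝ) : ℂ) = (√(2 * Real.pi / (b * m)) : ℝ) := by
    rw [integral_complex_ofReal]
    simp only [hGm]
    rw [integral_gaussian]
    congr 2
    field_simp
  have hGint : Integrable (fun θ => ((G θ ^ m : ℝ) : ℂ)) := by
    refine Integrable.ofReal (f := fun θ => G θ ^ m) ?_
    rw [funext hGm]
    exact integrable_exp_neg_mul_sq (by positivity)
  have hpoly : ∀ θ : ℝ, (θ ^ 2 + m * θ ^ 4 + m ^ 2 * θ ^ 6) * Real.exp (-(κ * (m * θ ^ 2))) ≤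
      P / m * Real.exp (-(κ / 2 * m) * θ ^ 2) := by
    intro θ
    have h := hP (m * θ ^ 2) (by positivity)
    have e1 : θ ^ 2 + m * θ ^ 4 + m ^ 2 * θ ^ 6 =
        (m * θ ^ 2 + (m * θ ^ 2) ^ 2 + (m * θ ^ 2) ^ 3) / m := by
      field_simp
    have e2 : Real.exp (-(κ / 2 * m) * θ ^ 2) =
        Real.exp (κ / 2 * (m * θ ^ 2)) * Real.exp (-(κ * (m * θ ^ 2))) := by
      rw [← Real.exp_add]
      congr 1
      ring
    rw [e1, e2, div_mul_eq_mul_div, div_mul_eq_mul_div, ← mul_assoc P]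
    exact div_le_div_of_nonneg_right (mul_le_mul_of_nonneg_right h (Real.exp_pos _).le) hm0.le
  have hF : Continuous fun θ => A θ * B θ ^ m - O θ := by fun_prop
  -- Extension by zero to the whole line lets one Gaussian bound serve both the interval and the
  -- tail of the Gaussian.
  have hI : ∫ θ, (Ioc (-r) r).indicator (fun θ => A θ * B θ ^ m - O θ) θ =
      ∫ θ in -r..r, A θ * B θ ^ m := by
    rw [integral_indicator measurableSet_Ioc,
      ← intervalIntegral.integral_of_le (by linarith : -r ≤ r),
      intervalIntegral.integral_sub, hO0, sub_zero]
    · exact (by fun_prop : Continuous fun θ => A θ * B θ ^ m).intervalIntegrable _ _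
    · exact hOc.intervalIntegrable _ _
  have hIint : Integrable ((Ioc (-r) r).indicator (fun θ => A θ * B θ ^ m - O θ)) := by
    rw [integrable_indicator_iff measurableSet_Ioc]
    exact (hF.continuousOn.integrableOn_Icc (a := -r) (b := r)).mono_set Ioc_subset_Icc_self
  rw [← hI, ← hGi, ← integral_sub hIint hGint]
  have hbound := norm_integral_le_of_norm_le
    (f := fun θ => (Ioc (-r) r).indicator (fun θ => A θ * B θ ^ m - O θ) θ - ((G θ ^ m : ℝ) : ℂ))
    (μ := volume) (g := fun θ => (K + 1) * (P / m) * Real.exp (-(κ / 2 * m) * θ ^ 2))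
    ((integrable_exp_neg_mul_sq (by positivity)).const_mul _) ?_
  · refine hbound.trans_eq ?_
    rw [integral_const_mul, integral_gaussian, Real.norm_of_nonneg (by positivity)]
    have : Real.pi / (κ / 2 * m) = 2 * Real.pi / κ / m := by field_simp
    rw [this, Real.sqrt_div (by positivity)]
    ring
  · refine Eventually.of_forall fun θ => ?_
    by_cases hθ : θ ∈ Ioc (-r) r
    · simp only [indicator_of_mem hθ]
      have h1 := hmain m hm θ (Ioc_subset_Icc_self hθ)
      have e : A θ * B θ ^ m - O θ - ((G θ ^ m : ℝ) : ℂ) = A θ * B θ ^ m -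
          ((G θ : ℂ) ^ m + O θ) := by
        push_cast
        ring
      rw [e]
      refine h1.trans ?_
      calc _ = K * ((θ ^ 2 + m * θ ^ 4 + m ^ 2 * θ ^ 6) * Real.exp (-(κ * (m * θ ^ 2)))) := by
            ring
        _ ≤ K * (P / m * Real.exp (-(κ / 2 * m) * θ ^ 2)) := by
            exact mul_le_mul_of_nonneg_left (hpoly θ) hK.le
        _ ≤ (K + 1) * (P / m * Real.exp (-(κ / 2 * m) * θ ^ 2)) := by
            gcongr
            linarith
        _ = _ := by ring
    · simp only [indicator_of_notMem hθ, zero_sub, norm_neg, Complex.norm_real]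
      rw [Real.norm_of_nonneg (by positivity)]
      -- This uses `1 ≤ r`: outside the interval the factor `θ ^ 2` is at least `1`, so the tail
      -- obeys the same bound `hpoly` as the error inside.
      have h1 : 1 ≤ θ ^ 2 := by
        have : 1 ≤ |θ| := by
          by_contra h
          push Not at h
          have := abs_lt.1 h
          exact hθ ⟨by linarith, by linarith⟩
        rw [← sq_abs]
        nlinarith
      calc G θ ^ m ≤ Real.exp (-(κ * (m * θ ^ 2))) := by
            rw [hGm]
            refine Real.exp_le_exp.2 ?_
            have : 0 ≤ (m : ℝ) * θ ^ 2 := by positivity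
            nlinarith
        _ ≤ (θ ^ 2 + m * θ ^ 4 + m ^ 2 * θ ^ 6) * Real.exp (-(κ * (m * θ ^ 2))) := by
            refine le_mul_of_one_le_left (Real.exp_pos _).le ?_
            have : 0 ≤ m * θ ^ 4 + m ^ 2 * θ ^ 6 := by positivity
            linarith
        _ ≤ P / m * Real.exp (-(κ / 2 * m) * θ ^ 2) := hpoly θ
        _ ≤ (K + 1) * (P / m * Real.exp (-(κ / 2 * m) * θ ^ 2)) :=
            le_mul_of_one_le_left (by positivity) (by linarith)
        _ = _ := by ring

/-! ### Degree series, contour integrals and Lagrange inversion -/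

namespace PlaneTree

open Filter Topology MeasureTheory Metric

/-- The power series `∑ (δ - 2) ^ k w ^ (δ - 2)` over `δ ∈ Δ`. -/
noncomputable def degreeSeries (Δ : Set ℕ) (k : ℕ) (w : ℂ) : ℂ :=
  ∑' δ : Δ, (((δ : ℕ) - 2 : ℕ) : ℂ) ^ k * w ^ ((δ : ℕ) - 2)

theorem sub_two_injective {Δ : Set ℕ} (hΔ : ∀ δ ∈ Δ, 3 ≤ δ) :
    Function.Injective fun δ : Δ => (δ : ℕ) - 2 := by
  intro x y h
  have h1 := hΔ x x.2
  have h2 := hΔ y y.2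
  simp only at h
  exact Subtype.ext (by omega)

theorem summable_degree_pow_mul {Δ : Set ℕ} (hΔ : ∀ δ ∈ Δ, 3 ≤ δ) (k : ℕ) {x : ℝ} (hx0 : 0 ≤ x)
    (hx1 : x < 1) :
    Summable fun δ : Δ => (((δ : ℕ) - 2 : ℕ) : ℝ) ^ k * x ^ ((δ : ℕ) - 2) :=
  (summable_pow_mul_geometric_of_norm_lt_one k (r := x)
    (by rwa [Real.norm_of_nonneg hx0])).comp_injective (sub_two_injective hΔ)

theorem summable_degreeSeries {Δ : Set ℕ} (hΔ : ∀ δ ∈ Δ, 3 ≤ δ) (k : ℕ) {w : ℂ} (hw : ‖w‖ < 1) :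
    Summable fun δ : Δ => (((δ : ℕ) - 2 : ℕ) : ℂ) ^ k * w ^ ((δ : ℕ) - 2) := by
  refine Summable.of_norm ?_
  simpa only [norm_mul, norm_pow, Complex.norm_natCast] using
    summable_degree_pow_mul hΔ k (norm_nonneg w) hw

/-- Termwise differentiation on a ball of radius `R < 1`. The product `w * d` is used because `w
d/dw` raises `k` by one, without division at `w = 0`. -/
theorem exists_hasDerivAt_degreeSeries {Δ : Set ℕ} (hΔ : ∀ δ ∈ Δ, 3 ≤ δ) (k : ℕ) {w : ℂ}
    (hw : ‖w‖ < 1) :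
    ∃ d : ℂ, HasDerivAt (degreeSeries Δ k) d w ∧ w * d = degreeSeries Δ (k + 1) w := by
  obtain ⟨R, hwR, hR1⟩ := exists_between hw
  have hR0 : 0 < R := (norm_nonneg w).trans_lt hwR
  refine ⟨∑' δ : Δ, (((δ : ℕ) - 2 : ℕ) : ℂ) ^ k *
    ((((δ : ℕ) - 2 : ℕ) : ℂ) * w ^ ((δ : ℕ) - 2 - 1)), ?_, ?_⟩
  · refine hasDerivAt_tsum_of_isPreconnected
      (u := fun δ : Δ => R⁻¹ * ((((δ : ℕ) - 2 : ℕ) : ℝ) ^ (k + 1) * R ^ ((δ : ℕ) - 2)))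
      ((summable_degree_pow_mul hΔ (k + 1) hR0.le hR1).mul_left _) isOpen_ball
      (convex_ball (0 : ℂ) R).isPreconnected
      (g' := fun (δ : Δ) w => (((δ : ℕ) - 2 : ℕ) : ℂ) ^ k *
        ((((δ : ℕ) - 2 : ℕ) : ℂ) * w ^ ((δ : ℕ) - 2 - 1)))
      (fun δ y _ => (hasDerivAt_pow _ y).const_mul _) ?_ (y₀ := 0) (mem_ball_self hR0)
      (summable_degreeSeries hΔ k (by simp)) (by simpa using hwR)
    intro δ y hy
    have h3 := hΔ δ δ.2
    rw [mem_ball_zero_iff] at hy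
    simp only [norm_mul, norm_pow, Complex.norm_natCast]
    obtain ⟨j, hj⟩ : ∃ j, (δ : ℕ) - 2 = j + 1 := ⟨(δ : ℕ) - 3, by omega⟩
    rw [hj, Nat.add_sub_cancel]
    calc _ = ((j + 1 : ℕ) : ℝ) ^ (k + 1) * ‖y‖ ^ j := by ring
      _ ≤ ((j + 1 : ℕ) : ℝ) ^ (k + 1) * R ^ j := by gcongr
      _ = _ := by
        rw [pow_succ R]
        field_simp
  · rw [degreeSeries, ← tsum_mul_left]
    refine tsum_congr fun δ => ?_
    have h3 := hΔ δ δ.2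
    obtain ⟨j, hj⟩ : ∃ j, (δ : ℕ) - 2 = j + 1 := ⟨(δ : ℕ) - 3, by omega⟩
    rw [hj, Nat.add_sub_cancel]
    ring

/-- Meant for curves with a known logarithmic derivative `l`: `circleMap` over `ℝ` and `slowCircle`
over `ℂ`. -/
theorem hasDerivAt_degreeSeries_comp {𝕜 : Type*} [NontriviallyNormedField 𝕜] [NormedAlgebra 𝕜 ℂ]
    {Δ : Set ℕ} (hΔ : ∀ δ ∈ Δ, 3 ≤ δ) (k : ℕ) {g : 𝕜 → ℂ} {z : 𝕜} {l : ℂ} (hg1 : ‖g z‖ < 1)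
    (hg : HasDerivAt g (g z * l) z) :
    HasDerivAt (fun z => degreeSeries Δ k (g z)) (degreeSeries Δ (k + 1) (g z) * l) z := by
  obtain ⟨d, hd, hd'⟩ := exists_hasDerivAt_degreeSeries hΔ k hg1
  rw [← hd', mul_comm (g z) d, mul_assoc]
  exact hd.comp z hg

theorem differentiableOn_degreeSeries {Δ : Set ℕ} (hΔ : ∀ δ ∈ Δ, 3 ≤ δ) (k : ℕ) :
    DifferentiableOn ℂ (degreeSeries Δ k) (ball 0 1) := by
  intro w hw
  obtain ⟨d, hd, -⟩ := exists_hasDerivAt_degreeSeries hΔ k (mem_ball_zero_iff.1 hw)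
  exact hd.differentiableAt.differentiableWithinAt

theorem norm_degreeSeries_zero_le {Δ : Set ℕ} (hΔ : ∀ δ ∈ Δ, 3 ≤ δ) {τ : ℝ} (hτ1 : τ < 1) {w : ℂ}
    (hw : ‖w‖ ≤ τ) : ‖degreeSeries Δ 0 w‖ ≤ ∑' δ : Δ, τ ^ ((δ : ℕ) - 2) := by
  have hs := summable_degree_pow_mul hΔ 0 ((norm_nonneg w).trans hw) hτ1
  simp only [pow_zero, one_mul] at hs
  refine tsum_of_norm_bounded hs.hasSum fun δ => ?_
  simp only [pow_zero, one_mul, norm_pow]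
  gcongr

theorem one_sub_degreeSeries_ne_zero {Δ : Set ℕ} (hΔ : ∀ δ ∈ Δ, 3 ≤ δ) {τ : ℝ} (hτ1 : τ < 1)
    (hS : ∑' δ : Δ, τ ^ ((δ : ℕ) - 2) < 1) {w : ℂ} (hw : ‖w‖ ≤ τ) :
    1 - degreeSeries Δ 0 w ≠ 0 := by
  intro h
  have h1 := norm_degreeSeries_zero_le hΔ hτ1 hw
  rw [← sub_eq_zero.1 h, norm_one] at h1
  linarith

/-- The coefficient of `w ^ (-N)` in `(1 - ∑ w ^ (δ - 2)) ^ (-M)`, as an average over the circle of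
radius `τ`. -/
noncomputable def cauchyCoeff (Δ : Set ℕ) (τ : ℝ) (N : ℤ) (M : ℕ) : ℂ :=
  Real.circleAverage (fun w => w ^ N * ((1 - degreeSeries Δ 0 w) ^ M)⁻¹) 0 τ

theorem continuousOn_inv_one_sub_pow {Δ : Set ℕ} (hΔ : ∀ δ ∈ Δ, 3 ≤ δ) {τ : ℝ} (hτ1 : τ < 1)
    (hS : ∑' δ : Δ, τ ^ ((δ : ℕ) - 2) < 1) (M : ℕ) :
    ContinuousOn (fun w => ((1 - degreeSeries Δ 0 w) ^ M)⁻¹) (closedBall 0 τ) := by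
  have h1 : ContinuousOn (degreeSeries Δ 0) (closedBall 0 τ) :=
    (differentiableOn_degreeSeries hΔ 0).continuousOn.mono (closedBall_subset_ball hτ1)
  refine ContinuousOn.inv₀ ((continuousOn_const.sub h1).pow M) fun w hw => pow_ne_zero _ ?_
  exact one_sub_degreeSeries_ne_zero hΔ hτ1 hS (mem_closedBall_zero_iff.1 hw)

/-- For `N ≥ 0` the function is holomorphic in the disc, so its average is its value at `0`, where
the series vanishes. These are the boundary values of the recursion. -/
theorem cauchyCoeff_natCast {Δ : Set ℕ} (hΔ : ∀ δ ∈ Δ, 3 ≤ δ) {τ : ℝ} (hτ0 : 0 < τ) (hτ1 : τ < 1)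
    (hS : ∑' δ : Δ, τ ^ ((δ : ℕ) - 2) < 1) (N M : ℕ) :
    cauchyCoeff Δ τ N M = if N = 0 then 1 else 0 := by
  have h : DiffContOnCl ℂ (fun w : ℂ => w ^ N * ((1 - degreeSeries Δ 0 w) ^ M)⁻¹)
      (ball 0 |τ|) := by
    rw [abs_of_pos hτ0]
    refine ⟨?_, ?_⟩
    · refine (differentiableOn_pow N).mul (DifferentiableOn.inv ?_ ?_)
      · exact (((differentiableOn_const (1 : ℂ)).sub ((differentiableOn_degreeSeries hΔ 0).mono
          (ball_subset_ball hτ1.le))).pow M)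
      · exact fun w hw => pow_ne_zero _
          (one_sub_degreeSeries_ne_zero hΔ hτ1 hS (mem_ball_zero_iff.1 hw).le)
    · rw [closure_ball _ hτ0.ne']
      exact (continuousOn_pow N).mul (continuousOn_inv_one_sub_pow hΔ hτ1 hS M)
  have h2 := h.circleAverage
  have h0 : degreeSeries Δ 0 0 = 0 := by
    rw [degreeSeries]
    refine (tsum_congr fun δ => ?_).trans tsum_zero
    have h3 := hΔ δ δ.2
    rw [zero_pow (by omega), mul_zero]
  simp only [cauchyCoeff, zpow_natCast]
  rw [h2, h0]
  by_cases hN : N = 0 <;> simp [hN]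

theorem norm_circleMap_zero_eq {τ : ℝ} (hτ0 : 0 < τ) (θ : ℝ) : ‖circleMap 0 τ θ‖ = τ := by
  rw [norm_circleMap_zero, abs_of_pos hτ0]

/-- Sum and integral are exchanged by dominated convergence. The cases `k = 0` and `k = 1` turn
identities between functions into recursions between coefficients. -/
theorem hasSum_circleAverage_mul {Δ : Set ℕ} (hΔ : ∀ δ ∈ Δ, 3 ≤ δ) {τ : ℝ} (hτ0 : 0 < τ)
    (hτ1 : τ < 1) {f : ℂ → ℂ} (hf : ContinuousOn f (closedBall 0 τ)) (N : ℤ) (k : ℕ) :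
    HasSum (fun δ : Δ => (((δ : ℕ) - 2 : ℕ) : ℂ) ^ k *
        Real.circleAverage (fun w => w ^ (N + ((δ : ℕ) - 2 : ℕ)) * f w) 0 τ)
      (Real.circleAverage (fun w => w ^ N * (degreeSeries Δ k w * f w)) 0 τ) := by
  simp only [Real.circleAverage, mul_smul_comm]
  refine HasSum.const_smul _ ?_
  simp only [← intervalIntegral.integral_const_mul]
  have hc : Continuous fun θ => f (circleMap 0 τ θ) :=
    hf.comp_continuous (continuous_circleMap 0 τ) fun θ =>
      mem_closedBall_zero_iff.2 (norm_circleMap_zero_eq hτ0 θ).le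
  have hz : ∀ (N : ℤ), Continuous fun θ => (circleMap 0 τ θ) ^ N := fun N =>
    (continuous_circleMap 0 τ).zpow₀ N fun θ => Or.inl (circleMap_ne_center hτ0.ne')
  obtain ⟨C, hC⟩ := (isCompact_closedBall (0 : ℂ) τ).exists_bound_of_continuousOn hf
  refine intervalIntegral.hasSum_integral_of_dominated_convergence
    (fun δ _ => (((δ : ℕ) - 2 : ℕ) : ℝ) ^ k * τ ^ ((δ : ℕ) - 2) * (τ ^ N * C)) ?_ ?_ ?_ ?_ ?_
  · exact fun δ => (continuous_const.mul ((hz _).mul hc)).aestronglyMeasurable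
  · refine fun δ => Eventually.of_forall fun θ _ => ?_
    have := hC (circleMap 0 τ θ) (mem_closedBall_zero_iff.2 (norm_circleMap_zero_eq hτ0 θ).le)
    simp only [norm_mul, norm_pow, norm_zpow, Complex.norm_natCast, norm_circleMap_zero_eq hτ0]
    rw [zpow_add₀ hτ0.ne', zpow_natCast]
    calc _ = (((δ : ℕ) - 2 : ℕ) : ℝ) ^ k * τ ^ ((δ : ℕ) - 2) *
          (τ ^ N * ‖f (circleMap 0 τ θ)‖) := by ring
      _ ≤ _ := by gcongr
  · exact Eventually.of_forall fun θ _ => (summable_degree_pow_mul hΔ k hτ0.le hτ1).mul_right _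
  · exact intervalIntegrable_const
  · refine Eventually.of_forall fun θ _ => ?_
    have hw : ‖circleMap 0 τ θ‖ < 1 := by rwa [norm_circleMap_zero_eq hτ0]
    have := ((summable_degreeSeries hΔ k hw).hasSum.mul_right
      (f (circleMap 0 τ θ))).mul_left (circleMap 0 τ θ ^ N)
    convert! this using 2 with δ
    rw [zpow_add₀ (circleMap_ne_center hτ0.ne'), zpow_natCast]
    ring

/-- Integrated form of `h (1 - h) ^ (-(M + 1)) = (1 - h) ^ (-(M + 1)) - (1 - h) ^ (-M)`. -/
theorem cauchyCoeff_eq_sub {Δ : Set ℕ} (hΔ : ∀ δ ∈ Δ, 3 ≤ δ) {τ : ℝ} (hτ0 : 0 < τ) (hτ1 : τ < 1)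
    (hS : ∑' δ : Δ, τ ^ ((δ : ℕ) - 2) < 1) (N : ℤ) (M : ℕ) :
    HasSum (fun δ : Δ => cauchyCoeff Δ τ (N + ((δ : ℕ) - 2 : ℕ)) (M + 1))
      (cauchyCoeff Δ τ N (M + 1) - cauchyCoeff Δ τ N M) := by
  have h := hasSum_circleAverage_mul hΔ hτ0 hτ1 (continuousOn_inv_one_sub_pow hΔ hτ1 hS (M + 1)) N 0
  simp only [pow_zero, one_mul] at h
  convert! h using 1
  have hint : ∀ (N : ℤ) M, CircleIntegrable
      (fun w : ℂ => w ^ N * ((1 - degreeSeries Δ 0 w) ^ M)⁻¹) 0 τ := by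
    intro N M
    refine ContinuousOn.circleIntegrable hτ0.le (ContinuousOn.mul ?_ ?_)
    · exact continuousOn_id.zpow₀ N fun w hw => Or.inl (ne_zero_of_mem_sphere hτ0.ne' ⟨w, hw⟩)
    · exact (continuousOn_inv_one_sub_pow hΔ hτ1 hS M).mono sphere_subset_closedBall
  rw [cauchyCoeff, cauchyCoeff, ← Real.circleAverage_fun_sub (hint _ _) (hint _ _)]
  refine Real.circleAverage_congr_sphere fun w hw => ?_
  rw [abs_of_pos hτ0, mem_sphere_zero_iff_norm] at hw
  have := one_sub_degreeSeries_ne_zero hΔ hτ1 hS hw.le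
  field_simp
  ring

/-- The derivative of `w ^ N (1 - h) ^ (-M)` along the closed circle integrates to zero. -/
theorem mul_cauchyCoeff {Δ : Set ℕ} (hΔ : ∀ δ ∈ Δ, 3 ≤ δ) {τ : ℝ} (hτ0 : 0 < τ) (hτ1 : τ < 1)
    (hS : ∑' δ : Δ, τ ^ ((δ : ℕ) - 2) < 1) (N : ℤ) (M : ℕ) :
    HasSum (fun δ : Δ => (M : ℂ) * ((((δ : ℕ) - 2 : ℕ) : ℂ) *
        cauchyCoeff Δ τ (N + ((δ : ℕ) - 2 : ℕ)) (M + 1)))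
      (-(N * cauchyCoeff Δ τ N M)) := by
  have h := hasSum_circleAverage_mul hΔ hτ0 hτ1 (continuousOn_inv_one_sub_pow hΔ hτ1 hS (M + 1)) N 1
  simp only [pow_one] at h
  convert! h.mul_left (M : ℂ) using 1
  rw [eq_comm, ← sub_eq_zero, sub_neg_eq_add]
  have hc : ∀ M, Continuous fun θ => ((1 - degreeSeries Δ 0 (circleMap 0 τ θ)) ^ M)⁻¹ := fun M =>
    (continuousOn_inv_one_sub_pow hΔ hτ1 hS M).comp_continuous (continuous_circleMap 0 τ)
      fun θ => mem_closedBall_zero_iff.2 (norm_circleMap_zero_eq hτ0 θ).le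
  have hd : Continuous fun θ => degreeSeries Δ 1 (circleMap 0 τ θ) :=
    (differentiableOn_degreeSeries hΔ 1).continuousOn.comp_continuous (continuous_circleMap 0 τ)
      fun θ => mem_ball_zero_iff.2 (by rwa [norm_circleMap_zero_eq hτ0])
  have hz : Continuous fun θ => (circleMap 0 τ θ) ^ N :=
    (continuous_circleMap 0 τ).zpow₀ N fun θ => Or.inl (circleMap_ne_center hτ0.ne')
  have hderiv : ∀ θ : ℝ, HasDerivAt
      (fun θ => circleMap 0 τ θ ^ N * ((1 - degreeSeries Δ 0 (circleMap 0 τ θ)) ^ M)⁻¹)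
      (Complex.I * (M * (circleMap 0 τ θ ^ N * (degreeSeries Δ 1 (circleMap 0 τ θ) *
        ((1 - degreeSeries Δ 0 (circleMap 0 τ θ)) ^ (M + 1))⁻¹)) +
        N * (circleMap 0 τ θ ^ N * ((1 - degreeSeries Δ 0 (circleMap 0 τ θ)) ^ M)⁻¹))) θ := by
    intro θ
    have h0 : circleMap 0 τ θ ≠ 0 := circleMap_ne_center hτ0.ne'
    have hn := norm_circleMap_zero_eq hτ0 θ
    have h1 := one_sub_degreeSeries_ne_zero hΔ hτ1 hS hn.le
    have hm := hasDerivAt_circleMap 0 τ θ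
    have e1 := (hasDerivAt_zpow N _ (Or.inl h0)).comp θ hm
    have e2 := hasDerivAt_degreeSeries_comp hΔ 0 (by rwa [hn]) hm
    have e3 := ((e2.const_sub 1).pow M).inv (pow_ne_zero M h1)
    convert! e1.mul e3 using 1
    -- The derivative of the `M`-th power contains the exponent `M - 1`, which is truncated at `M =
    -- 0`.
    rcases M with _ | M
    · simp [zpow_sub_one₀ h0]
      field_simp
    · simp only [Function.comp, zpow_sub_one₀ h0, Nat.add_sub_cancel, zero_add, Pi.pow_apply,
        Pi.inv_apply]
      field_simp
      push_cast
      ring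
  have hzero := intervalIntegral.integral_eq_sub_of_hasDerivAt (a := 0) (b := 2 * Real.pi)
    (fun θ _ => hderiv θ) (Continuous.intervalIntegrable (by fun_prop) _ _)
  have hper : circleMap 0 τ (2 * Real.pi) = circleMap 0 τ 0 := by
    have := periodic_circleMap 0 τ 0
    rwa [zero_add] at this
  rw [hper, sub_self, intervalIntegral.integral_const_mul, intervalIntegral.integral_add,
    intervalIntegral.integral_const_mul, intervalIntegral.integral_const_mul] at hzero
  · have := (mul_eq_zero.1 hzero).resolve_left Complex.I_ne_zero
    simp only [cauchyCoeff, Real.circleAverage, mul_smul_comm]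
    rw [← smul_add, this, smul_zero]
  · exact Continuous.intervalIntegrable (by fun_prop) _ _
  · exact Continuous.intervalIntegrable (by fun_prop) _ _

/-- Lagrange inversion for the number of forests. -/
theorem mul_forestCount {Δ : Set ℕ} (hΔ : ∀ δ ∈ Δ, 3 ≤ δ) {τ : ℝ} (hτ0 : 0 < τ) (hτ1 : τ < 1)
    (hS : ∑' δ : Δ, τ ^ ((δ : ℕ) - 2) < 1) (k n : ℕ) :
    ((n + 1 : ℕ) : ℂ) * forestCount Δ k (n + 1) =
      k * cauchyCoeff Δ τ ((k : ℤ) - (n + 1 : ℕ)) (n + 1) := by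
  classical
  -- With more trees than leaves both sides vanish: there is no forest, and the power of `w` is
  -- positive.
  have hlarge : ∀ k n : ℕ, n + 1 < k → ((n + 1 : ℕ) : ℂ) * forestCount Δ k (n + 1) =
      k * cauchyCoeff Δ τ ((k : ℤ) - (n + 1 : ℕ)) (n + 1) := by
    intro k n hk
    have e : ((k : ℤ) - (n + 1 : ℕ)) = ((k - (n + 1) : ℕ) : ℤ) := by omega
    rw [e, cauchyCoeff_natCast hΔ hτ0 hτ1 hS, if_neg (by omega), forestCount,
      forests_eq_empty hk]
    simp
  induction n generalizing k with
  | zero =>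
    rcases k with _ | _ | k
    · simp [forestCount, forests_zero_succ]
    · have h := cauchyCoeff_natCast hΔ hτ0 hτ1 hS 0 1
      have hF : forestCount Δ 1 1 = 1 := by
        rw [forestCount_succ hΔ, Finset.sum_eq_zero]
        · simp [forestCount, forests_zero_zero]
        · intro δ _
          have := hΔ δ δ.2
          rw [forestCount, forests_eq_empty (by omega), Set.ncard_empty]
      simp only [zero_add, hF]
      simpa using h.symm
    · exact hlarge _ _ (by omega)
  | succ n ih =>
    -- Downward induction on `k`: for the same number of leaves, the recursion refers to larger `k`
    -- only.
    obtain ⟨d, hd⟩ : ∃ d, d = n + 2 - k := ⟨_, rfl⟩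
    induction d using Nat.strong_induction_on generalizing k with
    | _ d ihd =>
      rcases lt_or_ge (n + 1 + 1) k with hk | hk
      · exact hlarge _ _ hk
      rcases k with _ | k
      · simp [forestCount, forests_zero_succ]
      have hN : (((k + 1 : ℕ) : ℤ) - (n + 1 + 1 : ℕ)) = (k : ℤ) - (n + 1 : ℕ) := by
        push_cast
        ring
      have hrec : ∀ δ : Δ, ((n + 1 + 1 : ℕ) : ℂ) * forestCount Δ (k + ((δ : ℕ) - 1)) (n + 1 + 1) =
          ((k : ℂ) + 1 + ((δ : ℕ) - 2 : ℕ)) *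
            cauchyCoeff Δ τ ((k : ℤ) - (n + 1 : ℕ) + ((δ : ℕ) - 2 : ℕ)) (n + 1 + 1) := by
        intro δ
        have h3 := hΔ δ δ.2
        have h4 : ((n + 1 + 1 : ℕ) : ℂ) * forestCount Δ (k + ((δ : ℕ) - 1)) (n + 1 + 1) =
            ((k + ((δ : ℕ) - 1) : ℕ) : ℂ) * cauchyCoeff Δ τ
              (((k + ((δ : ℕ) - 1) : ℕ) : ℤ) - (n + 1 + 1 : ℕ)) (n + 1 + 1) := by
          rcases lt_or_ge (n + 1 + 1) (k + ((δ : ℕ) - 1)) with h | h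
          · exact hlarge _ _ h
          · exact ihd _ (by omega) _ rfl
        rw [h4]
        have e1 : k + ((δ : ℕ) - 1) = k + 1 + ((δ : ℕ) - 2) := by omega
        rw [e1]
        congr 1
        · push_cast
          ring
        · congr 1
          push_cast
          ring
      have hsum1 := cauchyCoeff_eq_sub hΔ hτ0 hτ1 hS ((k : ℤ) - (n + 1 : ℕ)) (n + 1)
      have hsum2 := mul_cauchyCoeff hΔ hτ0 hτ1 hS ((k : ℤ) - (n + 1 : ℕ)) (n + 1)
      have hsum3 : HasSum (fun δ : Δ =>
          ((n + 1 : ℕ) : ℂ) * (((n + 1 + 1 : ℕ) : ℂ) *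
            forestCount Δ (k + ((δ : ℕ) - 1)) (n + 1 + 1)))
          (((n + 1 : ℕ) : ℂ) * (((n + 1 + 1 : ℕ) : ℂ) *
            ∑ δ ∈ (Finset.range (n + 1 + 4)).subtype (· ∈ Δ),
            (forestCount Δ (k + ((δ : ℕ) - 1)) (n + 1 + 1) : ℂ))) := by
        refine (HasSum.mul_left _ (hasSum_sum_of_ne_finset_zero ?_)).mul_left _
        intro δ hδ
        simp only [Finset.mem_subtype, Finset.mem_range] at hδ
        rw [forestCount, forests_eq_empty (by omega), Set.ncard_empty, Nat.cast_zero]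
      have hsum4 := (hsum1.mul_left (((n + 1 : ℕ) : ℂ) * ((k : ℂ) + 1))).add hsum2
      have huniq := hsum3.unique (by
        convert! hsum4 using 2 with δ
        rw [hrec]
        ring)
      have ihk := ih k
      have hrecF := forestCount_succ hΔ k (n + 1)
      rw [hN, hrecF]
      push_cast at huniq ihk ⊢
      have hn0 : ((n : ℂ) + 1) ≠ 0 := by exact_mod_cast Nat.succ_ne_zero n
      refine mul_left_cancel₀ hn0 ?_
      -- The coefficients with exponent `n + 1` cancel since `(n + 2) k - (n + 1) (k + 1) = k - (n +
      -- 1)`, and the last is the `N` of `mul_cauchyCoeff`.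
      linear_combination ((n : ℂ) + 1 + 1) * ihk + huniq


/-! ### Existence and uniqueness of the constants -/

open Filter Topology Set

/-- The sum `∑ (δ - 2) ^ k τ ^ (δ - 2)` over `δ ∈ Δ`, for real `τ`. -/
noncomputable def realDegreeSeries (Δ : Set ℕ) (k : ℕ) (τ : ℝ) : ℝ :=
  ∑' δ : Δ, (((δ : ℕ) - 2 : ℕ) : ℝ) ^ k * τ ^ ((δ : ℕ) - 2)

theorem hasSum_realDegreeSeries {Δ : Set ℕ} (hΔ : ∀ δ ∈ Δ, 3 ≤ δ) (k : ℕ) {τ : ℝ} (h0 : 0 ≤ τ)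
    (h1 : τ < 1) :
    HasSum (fun δ : Δ => (((δ : ℕ) - 2 : ℕ) : ℝ) ^ k * τ ^ ((δ : ℕ) - 2))
      (realDegreeSeries Δ k τ) :=
  (summable_degree_pow_mul hΔ k h0 h1).hasSum

theorem degreeSeries_ofReal (Δ : Set ℕ) (k : ℕ) (τ : ℝ) :
    degreeSeries Δ k τ = realDegreeSeries Δ k τ := by
  rw [degreeSeries, realDegreeSeries, Complex.ofReal_tsum]
  push_cast
  rfl

theorem cast_sub_two {Δ : Set ℕ} (hΔ : ∀ δ ∈ Δ, 3 ≤ δ) (δ : Δ) :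
    (((δ : ℕ) - 2 : ℕ) : ℝ) = (δ : ℝ) - 2 := by
  rw [Nat.cast_sub (by have := hΔ δ δ.2; omega)]
  norm_num

theorem one_le_cast_sub_two {Δ : Set ℕ} (hΔ : ∀ δ ∈ Δ, 3 ≤ δ) (δ : Δ) :
    (1 : ℝ) ≤ (((δ : ℕ) - 2 : ℕ) : ℝ) := by
  have := hΔ δ δ.2
  exact_mod_cast (by omega : 1 ≤ (δ : ℕ) - 2)

theorem realDegreeSeries_pos {Δ : Set ℕ} (hΔ : ∀ δ ∈ Δ, 3 ≤ δ) (hne : Δ.Nonempty) (k : ℕ) {τ : ℝ}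
    (h0 : 0 < τ) (h1 : τ < 1) : 0 < realDegreeSeries Δ k τ := by
  obtain ⟨δ, hδ⟩ := hne
  refine (summable_degree_pow_mul hΔ k h0.le h1).tsum_pos (fun _ => by positivity) ⟨δ, hδ⟩ ?_
  have := one_le_cast_sub_two hΔ ⟨δ, hδ⟩
  have h2 : (0 : ℝ) < (((⟨δ, hδ⟩ : Δ) : ℕ) - 2 : ℕ) := by linarith
  positivity

/-- The radius `τ` exists, and lies in the open disc of convergence. -/
theorem exists_realDegreeSeries_eq {Δ : Set ℕ} (hΔ : ∀ δ ∈ Δ, 3 ≤ δ) (hne : Δ.Nonempty) :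
    ∃ τ : ℝ, 0 < τ ∧ τ < 1 ∧ realDegreeSeries Δ 1 τ = 1 - realDegreeSeries Δ 0 τ := by
  obtain ⟨δ₀, hδ₀⟩ := hne
  have h3 := hΔ δ₀ hδ₀
  -- At `R = 1` a single term is already at least `2`, so the sum passes `1` strictly inside the
  -- unit disc, even if `Δ` is infinite.
  obtain ⟨R, hR0, hR1, hR⟩ : ∃ R : ℝ, 0 < R ∧ R < 1 ∧ 1 < ((δ₀ : ℝ) - 1) * R ^ (δ₀ - 2) := by
    have hc : ContinuousAt (fun R : ℝ => ((δ₀ : ℝ) - 1) * R ^ (δ₀ - 2)) 1 := by fun_prop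
    have hlt : (1 : ℝ) < ((δ₀ : ℝ) - 1) * 1 ^ (δ₀ - 2) := by
      have : (3 : ℝ) ≤ δ₀ := by exact_mod_cast h3
      rw [one_pow]
      linarith
    have h1 : ∀ᶠ R : ℝ in 𝓝[<] 1, 1 < ((δ₀ : ℝ) - 1) * R ^ (δ₀ - 2) :=
      (hc.eventually (lt_mem_nhds hlt)).filter_mono nhdsWithin_le_nhds
    have h2 : ∀ᶠ R : ℝ in 𝓝[<] 1, R ∈ Ioo (0 : ℝ) 1 := Ioo_mem_nhdsLT one_pos
    obtain ⟨R, h, h'⟩ := (h1.and h2).exists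
    exact ⟨R, h'.1, h'.2, h⟩
  have hcont : ∀ k, ContinuousOn (realDegreeSeries Δ k) (Icc 0 R) := by
    intro k
    refine continuousOn_tsum (fun δ => by fun_prop) (summable_degree_pow_mul hΔ k hR0.le hR1) ?_
    intro δ x hx
    rw [Real.norm_of_nonneg (by have := hx.1; positivity)]
    gcongr
    · exact hx.1
    · exact hx.2
  have hzero : ∀ k, realDegreeSeries Δ k 0 = 0 := by
    intro k
    refine (tsum_congr fun δ => ?_).trans tsum_zero
    rw [zero_pow (by have := hΔ δ δ.2; omega), mul_zero]
  have hlarge : 1 ≤ realDegreeSeries Δ 0 R + realDegreeSeries Δ 1 R := by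
    have hs := (hasSum_realDegreeSeries hΔ 0 hR0.le hR1).add (hasSum_realDegreeSeries hΔ 1 hR0.le hR1)
    have := le_hasSum hs ⟨δ₀, hδ₀⟩ fun _ _ => by positivity
    rw [cast_sub_two hΔ] at this
    simp only [pow_zero, pow_one, one_mul] at this
    nlinarith
  obtain ⟨τ, hτ, hτe⟩ := intermediate_value_Icc hR0.le ((hcont 0).add (hcont 1))
    (show (1 : ℝ) ∈ Icc _ _ from ⟨by simp [hzero], hlarge⟩)
  simp only [Pi.add_apply] at hτe
  refine ⟨τ, lt_of_le_of_ne hτ.1 ?_, hτ.2.trans_lt hR1, by linarith⟩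
  rintro rfl
  rw [hzero, hzero] at hτe
  norm_num at hτe

/-- The sums are rewritten by `δ - 1 = (δ - 2) + 1` and `(δ - 1) (δ - 2) = (δ - 2) ^ 2 + (δ - 2)`;
moreover `ρ = τ (1 - S_0) = τ S_1`. -/
theorem isTreeConstants {Δ : Set ℕ} (hΔ : ∀ δ ∈ Δ, 3 ≤ δ) (hne : Δ.Nonempty) {τ : ℝ}
    (h0 : 0 < τ) (h1 : τ < 1) (h : realDegreeSeries Δ 1 τ = 1 - realDegreeSeries Δ 0 τ) :
    IsTreeConstants Δ τ (τ * realDegreeSeries Δ 1 τ)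
      (√(2 * (τ * realDegreeSeries Δ 1 τ) /
        ((realDegreeSeries Δ 2 τ + realDegreeSeries Δ 1 τ) / τ))) := by
  have p1 := realDegreeSeries_pos hΔ hne 1 h0 h1
  have p2 := realDegreeSeries_pos hΔ hne 2 h0 h1
  have s0 := hasSum_realDegreeSeries hΔ 0 h0.le h1
  have s1 := hasSum_realDegreeSeries hΔ 1 h0.le h1
  have s2 := hasSum_realDegreeSeries hΔ 2 h0.le h1
  refine ⟨h0, by positivity, by positivity, ?_, ⟨τ * realDegreeSeries Δ 0 τ, ?_, ?_⟩,
    ⟨(realDegreeSeries Δ 2 τ + realDegreeSeries Δ 1 τ) / τ, ?_, rfl⟩⟩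
  · convert! s1.add s0 using 1
    · funext δ
      rw [cast_sub_two hΔ]
      ring
    · linarith
  · convert! s0.mul_left τ using 2 with δ
    have := hΔ δ δ.2
    rw [show (δ : ℕ) - 1 = (δ : ℕ) - 2 + 1 by omega, pow_succ]
    ring
  · rw [h]
    ring
  · convert! (s2.add s1).div_const τ using 2 with δ
    have := hΔ δ δ.2
    rw [cast_sub_two hΔ, show (δ : ℕ) - 2 = (δ : ℕ) - 3 + 1 by omega, pow_succ]
    field_simp
    ring

/-- Every term of the sum defining `τ` increases strictly with `τ`. Applied in both directions, this
gives uniqueness. -/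
theorem IsTreeConstants.tau_le {Δ : Set ℕ} (hΔ : ∀ δ ∈ Δ, 3 ≤ δ) (hne : Δ.Nonempty)
    {τ ρ γ τ' ρ' γ' : ℝ} (h : IsTreeConstants Δ τ ρ γ) (h' : IsTreeConstants Δ τ' ρ' γ') :
    τ' ≤ τ := by
  by_contra! hlt
  obtain ⟨δ₀, hδ₀⟩ := hne
  have hτ := h.tau_pos
  have key : ∀ δ : Δ, ((δ : ℝ) - 1) * τ ^ ((δ : ℕ) - 2) < ((δ : ℝ) - 1) * τ' ^ ((δ : ℕ) - 2) := by
    intro δ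
    have h3 := hΔ δ δ.2
    have : (3 : ℝ) ≤ (δ : ℝ) := by exact_mod_cast h3
    refine mul_lt_mul_of_pos_left (pow_lt_pow_left₀ hlt hτ.le (by omega)) (by linarith)
  have := hasSum_lt (fun δ => (key δ).le) (key ⟨δ₀, hδ₀⟩) h.tau_eq h'.tau_eq
  exact lt_irrefl _ this

theorem IsTreeConstants.unique {Δ : Set ℕ} (hΔ : ∀ δ ∈ Δ, 3 ≤ δ) (hne : Δ.Nonempty)
    {τ ρ γ τ' ρ' γ' : ℝ} (h : IsTreeConstants Δ τ ρ γ) (h' : IsTreeConstants Δ τ' ρ' γ') :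
    τ' = τ ∧ ρ' = ρ ∧ γ' = γ := by
  obtain rfl : τ' = τ := le_antisymm (h.tau_le hΔ hne h') (h'.tau_le hΔ hne h)
  obtain ⟨s, hs, hρ⟩ := h.rho_eq
  obtain ⟨s', hs', hρ'⟩ := h'.rho_eq
  obtain ⟨u, hu, hγ⟩ := h.gamma_eq
  obtain ⟨u', hu', hγ'⟩ := h'.gamma_eq
  obtain rfl := hs.unique hs'
  obtain rfl := hu.unique hu'
  subst hρ hρ' hγ hγ'
  exact ⟨rfl, rfl, rfl⟩


/-! ### The integrand on the circle of radius `τ` -/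

open Filter Topology Set Asymptotics

/-- Second-order data and the cubic Taylor remainder of an analytic function at `0`, along `ℝ`. -/
theorem _root_.AnalyticAt.exists_isBigO_cubic {f : ℂ → ℂ} (hf : AnalyticAt ℂ f 0) :
    ∃ c : ℂ, (fun θ : ℝ => f θ - (f 0 + deriv f 0 * θ + deriv (deriv f) 0 / 2 * θ ^ 2 +
      c * θ ^ 3)) =O[𝓝 0] fun θ : ℝ => θ ^ 4 := by
  refine ⟨iteratedDeriv 3 f 0 / 6, ?_⟩
  have h := hf.hasFPowerSeriesAt.isBigO_sub_partialSum_pow 4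
  have ht : Tendsto (fun θ : ℝ => (θ : ℂ)) (𝓝 0) (𝓝 0) := by
    simpa using Complex.continuous_ofReal.tendsto 0
  refine ((h.comp_tendsto ht).congr' ?_ ?_).trans (isBigO_refl _ _)
  · refine Eventually.of_forall fun θ => ?_
    simp [FormalMultilinearSeries.partialSum, Finset.sum_range_succ, Nat.factorial,
      iteratedDeriv_succ]
    ring
  · refine Eventually.of_forall fun θ => ?_
    simp [Even.pow_abs (show Even 4 by decide)]

theorem _root_.AnalyticAt.exists_isBigO_linear {f : ℂ → ℂ} (hf : AnalyticAt ℂ f 0) :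
    ∃ a : ℂ, (fun θ : ℝ => f θ - f 0 - a * θ) =O[𝓝 0] fun θ : ℝ => θ ^ 2 := by
  refine ⟨deriv f 0, ?_⟩
  have h := hf.hasFPowerSeriesAt.isBigO_sub_partialSum_pow 2
  have ht : Tendsto (fun θ : ℝ => (θ : ℂ)) (𝓝 0) (𝓝 0) := by
    simpa using Complex.continuous_ofReal.tendsto 0
  refine ((h.comp_tendsto ht).congr' ?_ ?_).trans (isBigO_refl _ _)
  · refine Eventually.of_forall fun θ => ?_
    simp [FormalMultilinearSeries.partialSum, Finset.sum_range_succ]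
    ring
  · refine Eventually.of_forall fun θ => ?_
    simp

/-- The circle of radius `τ`, run through at speed `1 / p`. -/
noncomputable def slowCircle (τ : ℝ) (p : ℕ) (z : ℂ) : ℂ := τ * Complex.exp (z * (Complex.I / p))

theorem hasDerivAt_slowCircle (τ : ℝ) (p : ℕ) (z : ℂ) :
    HasDerivAt (slowCircle τ p) (slowCircle τ p z * (Complex.I / p)) z := by
  convert! (((hasDerivAt_id z).mul_const (Complex.I / p)).cexp).const_mul (τ : ℂ) using 1
  simp [slowCircle, mul_assoc]

theorem norm_slowCircle_ofReal {τ : ℝ} (h0 : 0 < τ) (p : ℕ) (θ : ℝ) :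
    ‖slowCircle τ p θ‖ = τ := by
  have : (θ : ℂ) * (Complex.I / p) = ((θ / p : ℝ) : ℂ) * Complex.I := by
    push_cast
    ring
  rw [slowCircle, norm_mul, this, Complex.norm_exp_ofReal_mul_I, mul_one, Complex.norm_real,
    Real.norm_of_nonneg h0.le]

/-- The normalized factor `(1 - h(τ)) / (1 - h(w))` on the circle. -/
noncomputable def circleFactor (Δ : Set ℕ) (τ : ℝ) (p : ℕ) (z : ℂ) : ℂ :=
  realDegreeSeries Δ 1 τ / (1 - degreeSeries Δ 0 (slowCircle τ p z))

/-- The factor whose powers make up the coefficient integral. -/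
noncomputable def peakFactor (Δ : Set ℕ) (τ : ℝ) (p : ℕ) (z : ℂ) : ℂ :=
  circleFactor Δ τ p z ^ p * Complex.exp (-(z * Complex.I))

section

variable {Δ : Set ℕ} {τ : ℝ} {p : ℕ}

theorem tsum_pow_lt_one (hΔ : ∀ δ ∈ Δ, 3 ≤ δ) (hne : Δ.Nonempty) (h0 : 0 < τ) (h1 : τ < 1)
    (h : realDegreeSeries Δ 1 τ = 1 - realDegreeSeries Δ 0 τ) :
    ∑' δ : Δ, τ ^ ((δ : ℕ) - 2) < 1 := by
  have := realDegreeSeries_pos hΔ hne 1 h0 h1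
  have e : realDegreeSeries Δ 0 τ = ∑' δ : Δ, τ ^ ((δ : ℕ) - 2) := by simp [realDegreeSeries]
  rw [← e]
  linarith

theorem eventually_slowCircle (hΔ : ∀ δ ∈ Δ, 3 ≤ δ) (hne : Δ.Nonempty) (h0 : 0 < τ) (h1 : τ < 1)
    (h : realDegreeSeries Δ 1 τ = 1 - realDegreeSeries Δ 0 τ) (p : ℕ) :
    ∀ᶠ z in 𝓝 (0 : ℂ), ‖slowCircle τ p z‖ < 1 ∧ 1 - degreeSeries Δ 0 (slowCircle τ p z) ≠ 0 := by
  have hg : slowCircle τ p 0 = τ := by simp [slowCircle]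
  have hn : ‖slowCircle τ p 0‖ = τ := by simpa using norm_slowCircle_ofReal h0 p 0
  have hc := (hasDerivAt_slowCircle τ p 0).continuousAt
  have hd := (hasDerivAt_degreeSeries_comp hΔ 0 (by rwa [hn])
    (hasDerivAt_slowCircle τ p 0)).continuousAt
  refine (hc.norm.eventually_lt continuousAt_const (by rwa [hn])).and ?_
  exact (continuousAt_const.sub hd).eventually_ne
    (one_sub_degreeSeries_ne_zero hΔ h1 (tsum_pow_lt_one hΔ hne h0 h1 h) hn.le)

theorem hasDerivAt_circleFactor (hΔ : ∀ δ ∈ Δ, 3 ≤ δ) {z : ℂ} (h1 : ‖slowCircle τ p z‖ < 1)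
    (h2 : 1 - degreeSeries Δ 0 (slowCircle τ p z) ≠ 0) :
    HasDerivAt (circleFactor Δ τ p) (circleFactor Δ τ p z * (degreeSeries Δ 1 (slowCircle τ p z) *
      (Complex.I / p) / (1 - degreeSeries Δ 0 (slowCircle τ p z)))) z := by
  have e := hasDerivAt_degreeSeries_comp hΔ 0 h1 (hasDerivAt_slowCircle τ p z)
  convert! ((e.const_sub 1).inv h2).const_mul (realDegreeSeries Δ 1 τ : ℂ) using 1
  rw [circleFactor]
  field_simp

/-- The logarithmic derivative of `peakFactor`. -/
noncomputable def peakLogDeriv (Δ : Set ℕ) (τ : ℝ) (p : ℕ) (z : ℂ) : ℂ :=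
  Complex.I * (degreeSeries Δ 1 (slowCircle τ p z) /
    (1 - degreeSeries Δ 0 (slowCircle τ p z)) - 1)

theorem hasDerivAt_peakFactor (hΔ : ∀ δ ∈ Δ, 3 ≤ δ) (hp : p ≠ 0) {z : ℂ}
    (h1 : ‖slowCircle τ p z‖ < 1) (h2 : 1 - degreeSeries Δ 0 (slowCircle τ p z) ≠ 0) :
    HasDerivAt (peakFactor Δ τ p) (peakFactor Δ τ p z * peakLogDeriv Δ τ p z) z := by
  have e := hasDerivAt_circleFactor hΔ h1 h2
  have e2 : HasDerivAt (fun z => Complex.exp (-(z * Complex.I)))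
      (Complex.exp (-(z * Complex.I)) * -(1 * Complex.I)) z :=
    (((hasDerivAt_id z).mul_const Complex.I).neg).cexp
  convert! (e.pow p).mul e2 using 1
  obtain ⟨q, rfl⟩ := Nat.exists_eq_succ_of_ne_zero hp
  have hq : ((q + 1 : ℕ) : ℂ) ≠ 0 := by exact_mod_cast hp
  simp only [peakFactor, peakLogDeriv, Nat.succ_eq_add_one, Nat.add_sub_cancel, Pi.pow_apply]
  field_simp
  ring

theorem hasDerivAt_peakLogDeriv (hΔ : ∀ δ ∈ Δ, 3 ≤ δ) {z : ℂ}
    (h1 : ‖slowCircle τ p z‖ < 1) (h2 : 1 - degreeSeries Δ 0 (slowCircle τ p z) ≠ 0) :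
    HasDerivAt (peakLogDeriv Δ τ p) (-(1 / p) * (degreeSeries Δ 2 (slowCircle τ p z) /
      (1 - degreeSeries Δ 0 (slowCircle τ p z)) + (degreeSeries Δ 1 (slowCircle τ p z) /
      (1 - degreeSeries Δ 0 (slowCircle τ p z))) ^ 2)) z := by
  have e0 := hasDerivAt_degreeSeries_comp hΔ 0 h1 (hasDerivAt_slowCircle τ p z)
  have e1 := hasDerivAt_degreeSeries_comp hΔ 1 h1 (hasDerivAt_slowCircle τ p z)
  convert! ((e1.div (e0.const_sub 1) h2).sub_const 1).const_mul Complex.I using 1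
  simp only [zero_add, Nat.reduceAdd]
  field_simp
  linear_combination (-(1 / p) * (degreeSeries Δ 2 (slowCircle τ p z) *
    (1 - degreeSeries Δ 0 (slowCircle τ p z)) + degreeSeries Δ 1 (slowCircle τ p z) ^ 2)) *
      Complex.I_sq

theorem slowCircle_zero (τ : ℝ) (p : ℕ) : slowCircle τ p 0 = τ := by simp [slowCircle]

theorem circleFactor_zero (hS : 0 < realDegreeSeries Δ 1 τ)
    (h : realDegreeSeries Δ 1 τ = 1 - realDegreeSeries Δ 0 τ) : circleFactor Δ τ p 0 = 1 := by
  rw [circleFactor, slowCircle_zero, degreeSeries_ofReal]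
  have e : (1 : ℂ) - realDegreeSeries Δ 0 τ = realDegreeSeries Δ 1 τ := by
    rw [h]
    push_cast
    ring
  rw [e, div_self]
  exact_mod_cast hS.ne'

/-- The logarithmic derivative at `0` is `i (S_1 / (1 - S_0) - 1) = 0` by the choice of `τ`, so
there is no linear term. The second derivative is then the derivative of `peakLogDeriv`, namely
`-(S_2 / S_1 + 1) / p = -b`. -/
theorem peakFactor_expansion (hΔ : ∀ δ ∈ Δ, 3 ≤ δ) (hne : Δ.Nonempty) (h0 : 0 < τ) (h1 : τ < 1)
    (h : realDegreeSeries Δ 1 τ = 1 - realDegreeSeries Δ 0 τ) (hp : p ≠ 0) {b : ℝ}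
    (hb : b = (realDegreeSeries Δ 2 τ + realDegreeSeries Δ 1 τ) / (p * realDegreeSeries Δ 1 τ)) :
    ∃ c : ℂ, (fun θ : ℝ => peakFactor Δ τ p θ - (1 - b / 2 * θ ^ 2 + c * θ ^ 3)) =O[𝓝 0]
      fun θ : ℝ => θ ^ 4 := by
  have hev := eventually_slowCircle hΔ hne h0 h1 h p
  have hS := realDegreeSeries_pos hΔ hne 1 h0 h1
  have hderiv : deriv (peakFactor Δ τ p) =ᶠ[𝓝 0]
      fun z => peakFactor Δ τ p z * peakLogDeriv Δ τ p z := by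
    filter_upwards [hev] with z hz
    exact (hasDerivAt_peakFactor hΔ hp hz.1 hz.2).deriv
  have han : AnalyticAt ℂ (peakFactor Δ τ p) 0 := by
    rw [Complex.analyticAt_iff_eventually_differentiableAt]
    filter_upwards [hev] with z hz
    exact (hasDerivAt_peakFactor hΔ hp hz.1 hz.2).differentiableAt
  have hS' : (realDegreeSeries Δ 1 τ : ℂ) ≠ 0 := by exact_mod_cast hS.ne'
  have e : (1 : ℂ) - realDegreeSeries Δ 0 τ = realDegreeSeries Δ 1 τ := by
    rw [h]
    push_cast
    ring
  have hl0 : peakLogDeriv Δ τ p 0 = 0 := by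
    rw [peakLogDeriv, slowCircle_zero, degreeSeries_ofReal, degreeSeries_ofReal, e, div_self hS',
      sub_self, mul_zero]
  have hB0 : peakFactor Δ τ p 0 = 1 := by
    rw [peakFactor, circleFactor_zero hS h]
    simp
  have hd1 : deriv (peakFactor Δ τ p) 0 = 0 := by
    refine hderiv.self_of_nhds.trans ?_
    simp only [hl0, mul_zero]
  have hd2 : deriv (deriv (peakFactor Δ τ p)) 0 = -b := by
    rw [hderiv.deriv_eq]
    have hz := hev.self_of_nhds
    have := (hasDerivAt_peakFactor hΔ hp hz.1 hz.2).mul (hasDerivAt_peakLogDeriv hΔ hz.1 hz.2)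
    refine this.deriv.trans ?_
    rw [hl0, hB0, slowCircle_zero, degreeSeries_ofReal, degreeSeries_ofReal, degreeSeries_ofReal,
      e, hb]
    have hp' : (p : ℂ) ≠ 0 := by exact_mod_cast hp
    push_cast
    field_simp
    ring
  obtain ⟨c, hc⟩ := han.exists_isBigO_cubic
  refine ⟨c, hc.congr_left fun θ => ?_⟩
  rw [hB0, hd1, hd2]
  ring

theorem circleFactor_expansion (hΔ : ∀ δ ∈ Δ, 3 ≤ δ) (hne : Δ.Nonempty) (h0 : 0 < τ) (h1 : τ < 1)
    (h : realDegreeSeries Δ 1 τ = 1 - realDegreeSeries Δ 0 τ) :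
    ∃ a : ℂ, (fun θ : ℝ => circleFactor Δ τ p θ - 1 - a * θ) =O[𝓝 0] fun θ : ℝ => θ ^ 2 := by
  have han : AnalyticAt ℂ (circleFactor Δ τ p) 0 := by
    rw [Complex.analyticAt_iff_eventually_differentiableAt]
    filter_upwards [eventually_slowCircle hΔ hne h0 h1 h p] with z hz
    exact (hasDerivAt_circleFactor hΔ hz.1 hz.2).differentiableAt
  obtain ⟨a, ha⟩ := han.exists_isBigO_linear
  rw [circleFactor_zero (realDegreeSeries_pos hΔ hne 1 h0 h1) h] at ha
  exact ⟨a, ha⟩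

theorem continuous_circleFactor (hΔ : ∀ δ ∈ Δ, 3 ≤ δ) (hne : Δ.Nonempty) (h0 : 0 < τ) (h1 : τ < 1)
    (h : realDegreeSeries Δ 1 τ = 1 - realDegreeSeries Δ 0 τ) :
    Continuous fun θ : ℝ => circleFactor Δ τ p θ := by
  refine continuous_iff_continuousAt.2 fun θ => ?_
  have hn := norm_slowCircle_ofReal h0 p θ
  have := (hasDerivAt_circleFactor (p := p) (z := θ) hΔ (by rwa [hn])
    (one_sub_degreeSeries_ne_zero hΔ h1 (tsum_pow_lt_one hΔ hne h0 h1 h) hn.le)).continuousAt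
  exact this.comp (f := fun θ : ℝ => (θ : ℂ)) Complex.continuous_ofReal.continuousAt

theorem continuous_peakFactor (hΔ : ∀ δ ∈ Δ, 3 ≤ δ) (hne : Δ.Nonempty) (h0 : 0 < τ) (h1 : τ < 1)
    (h : realDegreeSeries Δ 1 τ = 1 - realDegreeSeries Δ 0 τ) :
    Continuous fun θ : ℝ => peakFactor Δ τ p θ := by
  have := continuous_circleFactor (p := p) hΔ hne h0 h1 h
  unfold peakFactor
  fun_prop

/-- The least common multiple of two common divisors is again a common divisor, so it cannot exceed
`p`. -/
theorem dvd_of_isGreatest (hp : IsGreatest {d : ℕ | ∀ δ ∈ Δ, d ∣ δ - 2} p) (hp0 : p ≠ 0) {d : ℕ}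
    (hd : ∀ δ ∈ Δ, d ∣ δ - 2) (hd0 : d ≠ 0) : d ∣ p := by
  have h1 : Nat.lcm d p ≤ p := hp.2 fun δ hδ => Nat.lcm_dvd (hd δ hδ) (hp.1 δ hδ)
  have h2 : Nat.lcm d p = p :=
    le_antisymm h1 (Nat.le_of_dvd (Nat.pos_of_ne_zero (Nat.lcm_ne_zero hd0 hp0))
      (Nat.dvd_lcm_right d p))
  rw [← h2]
  exact Nat.dvd_lcm_left d p

/-- The order of `ζ` is a common divisor of all `δ - 2`, and it is nonzero as `δ - 2 > 0`. -/
theorem exp_eq_one_of_forall_pow (hΔ : ∀ δ ∈ Δ, 3 ≤ δ) (hne : Δ.Nonempty)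
    (hp : IsGreatest {d : ℕ | ∀ δ ∈ Δ, d ∣ δ - 2} p) (hp0 : p ≠ 0) {ζ : ℂ}
    (hζ : ∀ δ ∈ Δ, ζ ^ (δ - 2) = 1) : ζ ^ p = 1 := by
  have hd : ∀ δ ∈ Δ, orderOf ζ ∣ δ - 2 := fun δ hδ => orderOf_dvd_of_pow_eq_one (hζ δ hδ)
  obtain ⟨δ, hδ⟩ := hne
  have h3 := hΔ δ hδ
  have hd0 : orderOf ζ ≠ 0 := by
    intro h
    have := hd δ hδ
    rw [h, zero_dvd_iff] at this
    omega
  exact orderOf_dvd_iff_pow_eq_one.1 (dvd_of_isGreatest hp hp0 hd hd0)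

/-- One has `|1 - h(w)| ≥ 1 - Re h(w) ≥ 1 - h(τ) = S_1`. Equality in the second bound forces `exp(iθ
/ p) ^ (δ - 2) = 1` for all `δ`, hence `exp(iθ) = 1` because `p` is the greatest common divisor,
hence `θ = 0`. -/
theorem norm_circleFactor_lt (hΔ : ∀ δ ∈ Δ, 3 ≤ δ) (hne : Δ.Nonempty) (h0 : 0 < τ) (h1 : τ < 1)
    (h : realDegreeSeries Δ 1 τ = 1 - realDegreeSeries Δ 0 τ)
    (hp : IsGreatest {d : ℕ | ∀ δ ∈ Δ, d ∣ δ - 2} p) (hp0 : p ≠ 0) {θ : ℝ}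
    (hθ : θ ∈ Icc (-Real.pi) Real.pi) (hθ0 : θ ≠ 0) : ‖circleFactor Δ τ p θ‖ < 1 := by
  have hS := realDegreeSeries_pos hΔ hne 1 h0 h1
  have hn := norm_slowCircle_ofReal h0 p θ
  have hpc : (p : ℂ) ≠ 0 := by exact_mod_cast hp0
  have hterm : ∀ δ : Δ, ((((δ : ℕ) - 2 : ℕ) : ℂ) ^ 0 * slowCircle τ p θ ^ ((δ : ℕ) - 2)).re =
      τ ^ ((δ : ℕ) - 2) * Real.cos (((δ : ℕ) - 2 : ℕ) * (θ / p)) := by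
    intro δ
    have e : (((δ : ℕ) - 2 : ℕ) : ℂ) * (θ * (Complex.I / p)) =
        (((((δ : ℕ) - 2 : ℕ) : ℝ) * (θ / p) : ℝ) : ℂ) * Complex.I := by
      push_cast
      ring
    rw [pow_zero, one_mul, slowCircle, mul_pow, ← Complex.exp_nat_mul, e, ← Complex.ofReal_pow,
      Complex.re_ofReal_mul, Complex.exp_ofReal_mul_I_re]
  have hex : ∃ δ : Δ, Real.cos (((δ : ℕ) - 2 : ℕ) * (θ / p)) < 1 := by
    by_contra! hall
    have hζ : ∀ δ ∈ Δ, Complex.exp (θ / p * Complex.I) ^ (δ - 2) = 1 := by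
      intro δ hδ
      obtain ⟨n, hn⟩ := (Real.cos_eq_one_iff _).1
        (le_antisymm (Real.cos_le_one _) (hall ⟨δ, hδ⟩))
      rw [← Complex.exp_nat_mul, Complex.exp_eq_one_iff]
      refine ⟨n, ?_⟩
      have : (((δ - 2 : ℕ) : ℂ)) * (θ / p) = n * (2 * Real.pi) := by
        exact_mod_cast congrArg (fun x : ℝ => (x : ℂ)) hn.symm
      rw [← mul_assoc, this]
      ring
    have h2 := exp_eq_one_of_forall_pow hΔ hne hp hp0 hζ
    rw [← Complex.exp_nat_mul, Complex.exp_eq_one_iff] at h2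
    obtain ⟨n, hn⟩ := h2
    have h3 : (θ : ℂ) = n * (2 * Real.pi) := by
      have : (p : ℂ) * (θ / p * Complex.I) = θ * Complex.I := by field_simp
      rw [this, ← mul_assoc] at hn
      exact mul_right_cancel₀ Complex.I_ne_zero hn
    have h4 : θ = n * (2 * Real.pi) := by exact_mod_cast h3
    have hpi := Real.pi_pos
    have hn1 : n < 1 := by
      by_contra! hge
      have : (1 : ℝ) ≤ n := by exact_mod_cast hge
      nlinarith [hθ.2]
    have hn2 : -1 < n := by
      by_contra! hle
      have : (n : ℝ) ≤ -1 := by exact_mod_cast hle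
      nlinarith [hθ.1]
    obtain rfl : n = 0 := by omega
    simp at h4
    exact hθ0 h4
  obtain ⟨δ₀, hδ₀⟩ := hex
  have hre : (degreeSeries Δ 0 (slowCircle τ p θ)).re < realDegreeSeries Δ 0 τ := by
    have s1 := Complex.reCLM.hasSum
      (summable_degreeSeries hΔ 0 (w := slowCircle τ p θ) (by rwa [hn])).hasSum
    have s2 := hasSum_realDegreeSeries hΔ 0 h0.le h1
    have hle : ∀ δ : Δ, τ ^ ((δ : ℕ) - 2) * Real.cos (((δ : ℕ) - 2 : ℕ) * (θ / p)) ≤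
        τ ^ ((δ : ℕ) - 2) := fun δ =>
      mul_le_of_le_one_right (by positivity) (Real.cos_le_one _)
    refine hasSum_lt (i := δ₀) ?_ ?_ s1 s2
    · intro δ
      simp only [Complex.reCLM_apply, hterm]
      rw [pow_zero, one_mul]
      exact hle δ
    · simp only [Complex.reCLM_apply, hterm]
      rw [pow_zero, one_mul]
      exact mul_lt_of_lt_one_right (by positivity) hδ₀
  have hlt : realDegreeSeries Δ 1 τ < ‖1 - degreeSeries Δ 0 (slowCircle τ p θ)‖ := by
    refine lt_of_lt_of_le ?_ (Complex.re_le_norm _)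
    rw [Complex.sub_re, Complex.one_re]
    linarith
  rw [circleFactor, norm_div, Complex.norm_real, Real.norm_of_nonneg hS.le,
    div_lt_one (hS.trans hlt)]
  exact hlt

theorem norm_peakFactor_lt (hΔ : ∀ δ ∈ Δ, 3 ≤ δ) (hne : Δ.Nonempty) (h0 : 0 < τ) (h1 : τ < 1)
    (h : realDegreeSeries Δ 1 τ = 1 - realDegreeSeries Δ 0 τ)
    (hp : IsGreatest {d : ℕ | ∀ δ ∈ Δ, d ∣ δ - 2} p) (hp0 : p ≠ 0) {θ : ℝ}
    (hθ : θ ∈ Icc (-Real.pi) Real.pi) (hθ0 : θ ≠ 0) : ‖peakFactor Δ τ p θ‖ < 1 := by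
  have e : -((θ : ℂ) * Complex.I) = ((-θ : ℝ) : ℂ) * Complex.I := by
    push_cast
    ring
  rw [peakFactor, norm_mul, norm_pow, e, Complex.norm_exp_ofReal_mul_I, mul_one]
  exact pow_lt_one₀ (norm_nonneg _) (norm_circleFactor_lt hΔ hne h0 h1 h hp hp0 hθ hθ0) hp0

/-- At `θ = p α` the point is `w = τ exp(iα)`, and `exp(-iθ) ^ m = (τ / w) ^ (m p)`. The extra
`circleFactor` makes the exponent `m p + 1`, as Lagrange inversion requires. -/
theorem circleFactor_mul_peakFactor_pow (hp0 : p ≠ 0) (h0 : 0 < τ) (m : ℕ) (α : ℝ) :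
    circleFactor Δ τ p ((p * α : ℝ)) * peakFactor Δ τ p ((p * α : ℝ)) ^ m =
      (τ : ℂ) ^ (m * p) * (realDegreeSeries Δ 1 τ : ℂ) ^ (m * p + 1) *
        (circleMap 0 τ α ^ (-(m * p : ℕ) : ℤ) *
          ((1 - degreeSeries Δ 0 (circleMap 0 τ α)) ^ (m * p + 1))⁻¹) := by
  have hpc : (p : ℂ) ≠ 0 := by exact_mod_cast hp0
  have hτ : (τ : ℂ) ≠ 0 := by exact_mod_cast h0.ne'
  have hs : slowCircle τ p ((p * α : ℝ)) = circleMap 0 τ α := by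
    rw [slowCircle, circleMap, zero_add]
    congr 2
    push_cast
    field_simp
  have he : Complex.exp (-(((p * α : ℝ) : ℂ) * Complex.I)) ^ m =
      (τ : ℂ) ^ (m * p) * circleMap 0 τ α ^ (-(m * p : ℕ) : ℤ) := by
    rw [circleMap, zero_add, zpow_neg, zpow_natCast, mul_pow, mul_inv, ← mul_assoc,
      mul_inv_cancel₀ (pow_ne_zero _ hτ), one_mul, ← Complex.exp_nat_mul, ← Complex.exp_nat_mul,
      ← Complex.exp_neg]
    congr 1
    push_cast
    ring
  rw [peakFactor, mul_pow, he, circleFactor, hs]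
  rw [← pow_mul, mul_comm p m, div_eq_mul_inv, mul_pow, pow_succ, pow_succ, mul_inv, inv_pow]
  ring

/-- The series depends on `w ^ p` only, which has period `2π` in `θ` although `w` itself need not.
-/
theorem circleFactor_mul_peakFactor_periodic (hp : ∀ δ ∈ Δ, p ∣ δ - 2) (hp0 : p ≠ 0) (m : ℕ) :
    Function.Periodic (fun θ : ℝ => circleFactor Δ τ p θ * peakFactor Δ τ p θ ^ m)
      (2 * Real.pi) := by
  have hpc : (p : ℂ) ≠ 0 := by exact_mod_cast hp0
  intro θ
  have hD : degreeSeries Δ 0 (slowCircle τ p ((θ + 2 * Real.pi : ℝ))) =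
      degreeSeries Δ 0 (slowCircle τ p θ) := by
    refine tsum_congr fun δ => ?_
    obtain ⟨j, hj⟩ := hp δ δ.2
    have : slowCircle τ p ((θ + 2 * Real.pi : ℝ)) ^ p = slowCircle τ p θ ^ p := by
      rw [slowCircle, slowCircle, mul_pow, mul_pow, ← Complex.exp_nat_mul, ← Complex.exp_nat_mul]
      congr 1
      rw [← Complex.exp_periodic ((p : ℂ) * (θ * (Complex.I / p)))]
      congr 1
      push_cast
      field_simp
    rw [hj, pow_mul, pow_mul, this]
  have hE : Complex.exp (-(((θ + 2 * Real.pi : ℝ) : ℂ) * Complex.I)) =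
      Complex.exp (-((θ : ℂ) * Complex.I)) := by
    rw [← Complex.exp_periodic (-(((θ + 2 * Real.pi : ℝ) : ℂ) * Complex.I))]
    congr 1
    push_cast
    ring
  simp only [circleFactor, peakFactor, hD, hE]

/-- The coefficient of Lagrange inversion as an integral with a single peak. -/
theorem cauchyCoeff_eq_integral (hΔ : ∀ δ ∈ Δ, 3 ≤ δ) (hne : Δ.Nonempty) (h0 : 0 < τ)
    (h1 : τ < 1) (h : realDegreeSeries Δ 1 τ = 1 - realDegreeSeries Δ 0 τ)
    (hp : ∀ δ ∈ Δ, p ∣ δ - 2) (hp0 : p ≠ 0) (m : ℕ) :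
    (τ : ℂ) ^ (m * p) * (realDegreeSeries Δ 1 τ : ℂ) ^ (m * p + 1) *
      cauchyCoeff Δ τ (-(m * p : ℕ)) (m * p + 1) =
      (2 * Real.pi)⁻¹ * ∫ θ in -Real.pi..Real.pi,
        circleFactor Δ τ p θ * peakFactor Δ τ p θ ^ m := by
  have hpr : (p : ℝ) ≠ 0 := by exact_mod_cast hp0
  have hper := circleFactor_mul_peakFactor_periodic (τ := τ) hp hp0 m
  have e1 : ∫ θ in -Real.pi..Real.pi, circleFactor Δ τ p θ * peakFactor Δ τ p θ ^ m =
      ∫ θ in (0 : ℝ)..2 * Real.pi, circleFactor Δ τ p θ * peakFactor Δ τ p θ ^ m := by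
    have := hper.intervalIntegral_add_eq (-Real.pi) 0
    rwa [zero_add, show -Real.pi + 2 * Real.pi = Real.pi by ring] at this
  have e2 : ∫ α in (0 : ℝ)..2 * Real.pi, circleFactor Δ τ p ((p * α : ℝ)) *
      peakFactor Δ τ p ((p * α : ℝ)) ^ m =
      ∫ θ in (0 : ℝ)..2 * Real.pi, circleFactor Δ τ p θ * peakFactor Δ τ p θ ^ m := by
    have hcomp := intervalIntegral.integral_comp_mul_left (a := 0) (b := 2 * Real.pi)
      (fun θ : ℝ => circleFactor Δ τ p θ * peakFactor Δ τ p θ ^ m) hpr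
    have hc1 := continuous_circleFactor (p := p) hΔ hne h0 h1 h
    have hc2 := continuous_peakFactor (p := p) hΔ hne h0 h1 h
    -- As `α` runs once around the circle, `θ = p α` runs through `p` periods; the factor `p`
    -- cancels against the change of variable.
    have hmul := hper.intervalIntegral_add_zsmul_eq (p : ℤ) 0
      fun _ _ => (hc1.mul (hc2.pow m)).intervalIntegrable _ _
    rw [hcomp, mul_zero]
    simp only [zero_add, zsmul_eq_mul, Int.cast_natCast] at hmul
    rw [hmul]
    rw [Complex.real_smul, ← mul_assoc]
    push_cast
    rw [inv_mul_cancel₀ (by exact_mod_cast hp0), one_mul]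
  rw [e1, ← e2]
  simp only [circleFactor_mul_peakFactor_pow hp0 h0]
  rw [intervalIntegral.integral_const_mul, cauchyCoeff, Real.circleAverage, Complex.real_smul]
  push_cast
  ring

end


/-! ### Asymptotics of the number of trees -/

open Filter Topology Set Asymptotics

/-- `J m` is the peak integral, which is real because Lagrange inversion with one tree and `m p + 1`
leaves identifies it with a multiple of the count. -/
theorem exists_isBigO_treeCount {Δ : Set ℕ} (hΔ : ∀ δ ∈ Δ, 3 ≤ δ) (hne : Δ.Nonempty) {p : ℕ}
    (hp : IsGreatest {d : ℕ | ∀ δ ∈ Δ, d ∣ δ - 2} p) (hp0 : p ≠ 0) {τ : ℝ} (h0 : 0 < τ)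
    (h1 : τ < 1) (h : realDegreeSeries Δ 1 τ = 1 - realDegreeSeries Δ 0 τ) {b : ℝ}
    (hb : b = (realDegreeSeries Δ 2 τ + realDegreeSeries Δ 1 τ) / (p * realDegreeSeries Δ 1 τ)) :
    ∃ J : ℕ → ℝ, (fun m : ℕ => J m - √(2 * Real.pi / (b * m))) =O[atTop]
        (fun m : ℕ => 1 / ((m : ℝ) * √m)) ∧
      ∀ m : ℕ, J m * τ = 2 * Real.pi * (τ * realDegreeSeries Δ 1 τ) ^ (m * p + 1) *
        ((m * p + 1) * treeCount Δ (m * p + 1)) := by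
  have p1 := realDegreeSeries_pos hΔ hne 1 h0 h1
  have p2 := realDegreeSeries_pos hΔ hne 2 h0 h1
  have hpr : (0 : ℝ) < p := by exact_mod_cast Nat.pos_of_ne_zero hp0
  have hb0 : 0 < b := by
    rw [hb]
    positivity
  obtain ⟨a, ha⟩ := circleFactor_expansion (p := p) hΔ hne h0 h1 h
  obtain ⟨c, hc⟩ := peakFactor_expansion hΔ hne h0 h1 h hp0 hb
  have hL := integral_mul_pow_sub_isBigO (continuous_circleFactor hΔ hne h0 h1 h)
    (continuous_peakFactor hΔ hne h0 h1 h) hb0 ha hc (r := Real.pi)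
    (by linarith [Real.pi_gt_three])
    fun θ hθ hθ0 => norm_peakFactor_lt hΔ hne h0 h1 h hp hp0 hθ hθ0
  have key : ∀ m : ℕ, (∫ θ in -Real.pi..Real.pi, circleFactor Δ τ p θ * peakFactor Δ τ p θ ^ m) =
      ((2 * Real.pi * (τ * realDegreeSeries Δ 1 τ) ^ (m * p + 1) *
        ((m * p + 1) * treeCount Δ (m * p + 1)) / τ : ℝ) : ℂ) := by
    intro m
    have e1 := cauchyCoeff_eq_integral hΔ hne h0 h1 h hp.1 hp0 m
    have e2 := mul_forestCount hΔ h0 h1 (tsum_pow_lt_one hΔ hne h0 h1 h) 1 (m * p)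
    have e3 : (((1 : ℕ) : ℤ) - (m * p + 1 : ℕ)) = -(m * p : ℕ) := by
      push_cast
      ring
    rw [e3, Nat.cast_one, one_mul] at e2
    rw [← e2] at e1
    have hτc : (τ : ℂ) ≠ 0 := by exact_mod_cast h0.ne'
    have hpi : (Real.pi : ℂ) ≠ 0 := by exact_mod_cast Real.pi_ne_zero
    have e4 : treeCount Δ (m * p + 1) = forestCount Δ 1 (m * p + 1) :=
      treeCount_eq_ncard_forests Δ _
    rw [e4]
    push_cast at e1 ⊢
    rw [eq_inv_mul_iff_mul_eq₀ (mul_ne_zero two_ne_zero hpi)] at e1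
    rw [← e1, mul_pow, pow_succ (τ : ℂ)]
    field_simp
  refine ⟨fun m => 2 * Real.pi * (τ * realDegreeSeries Δ 1 τ) ^ (m * p + 1) *
        ((m * p + 1) * treeCount Δ (m * p + 1)) / τ, ?_, fun m => div_mul_cancel₀ _ h0.ne'⟩
  refine (hL.norm_left.congr_left fun m => ?_).of_norm_left
  rw [key, ← Complex.ofReal_sub, Complex.norm_real]

theorem sqrt_div_sub_one_le {x : ℝ} (hx : 0 ≤ x) : |√(1 + x) - 1| ≤ x := by
  have h1 : 1 ≤ √(1 + x) := Real.one_le_sqrt.2 (by linarith)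
  rw [abs_of_nonneg (by linarith)]
  have h2 : √(1 + x) ≤ 1 + x := Real.sqrt_le_iff.2 ⟨by linarith, by nlinarith⟩
  linarith

/-- The constant `κ` normalizes the main term to `√(1 + 1 / (m p))`, which is `1 + O(1 / m)`; the
error of `J` is multiplied by `O(√m)`. -/
theorem relative_error_isBigO {J : ℕ → ℝ} {b κ : ℝ} {p : ℕ} (hp0 : p ≠ 0) (hb0 : 0 < b)
    (hJ : (fun m : ℕ => J m - √(2 * Real.pi / (b * m))) =O[atTop]
      (fun m : ℕ => 1 / ((m : ℝ) * √m))) (hκ : κ * √(2 * Real.pi / b) = 1 / √p) :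
    (fun m : ℕ => κ * √((m : ℝ) * p + 1) * J m - 1) =O[atTop] fun m : ℕ => 1 / (m : ℝ) := by
  have hpr : (1 : ℝ) ≤ p := by exact_mod_cast Nat.one_le_iff_ne_zero.2 hp0
  have t1 : (fun m : ℕ => κ * √((m : ℝ) * p + 1) * (J m - √(2 * Real.pi / (b * m)))) =O[atTop]
      fun m : ℕ => 1 / (m : ℝ) := by
    have e1 : (fun m : ℕ => κ * √((m : ℝ) * p + 1)) =O[atTop] fun m : ℕ => √(m : ℝ) := by
      refine IsBigO.of_bound (|κ| * √(2 * p)) ?_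
      filter_upwards [eventually_ge_atTop 1] with m hm
      have hm1 : (1 : ℝ) ≤ m := by exact_mod_cast hm
      rw [norm_mul, Real.norm_eq_abs, Real.norm_of_nonneg (Real.sqrt_nonneg _),
        Real.norm_of_nonneg (Real.sqrt_nonneg _), mul_assoc, ← Real.sqrt_mul (by positivity)]
      gcongr
      nlinarith
    refine (e1.mul hJ).trans_eventuallyEq ?_
    filter_upwards [eventually_ge_atTop 1] with m hm
    have hm1 : (0 : ℝ) < m := by exact_mod_cast hm
    have := Real.sqrt_pos.2 hm1
    field_simp
  have t2 : (fun m : ℕ => √(1 + 1 / ((m : ℝ) * p)) - 1) =O[atTop] fun m : ℕ => 1 / (m : ℝ) := by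
    refine IsBigO.of_bound 1 ?_
    filter_upwards [eventually_ge_atTop 1] with m hm
    have hm1 : (0 : ℝ) < m := by exact_mod_cast hm
    rw [Real.norm_eq_abs, Real.norm_of_nonneg (by positivity), one_mul]
    refine (sqrt_div_sub_one_le (by positivity)).trans ?_
    gcongr
    nlinarith
  refine (t1.add t2).congr' ?_ EventuallyEq.rfl
  filter_upwards [eventually_ge_atTop 1] with m hm
  have hm1 : (0 : ℝ) < m := by exact_mod_cast hm
  have e : κ * √((m : ℝ) * p + 1) * √(2 * Real.pi / (b * m)) = √(1 + 1 / ((m : ℝ) * p)) := by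
    rw [← div_div, Real.sqrt_div (by positivity)]
    calc _ = κ * √(2 * Real.pi / b) * √((m : ℝ) * p + 1) / √m := by ring
      _ = √((m : ℝ) * p + 1) / (√p * √m) := by
        rw [hκ]
        field_simp
      _ = _ := by
        rw [← Real.sqrt_mul (by positivity), ← Real.sqrt_div (by positivity)]
        congr 1
        field_simp
  rw [mul_sub, e]
  ring

end PlaneTree

theorem mainTheorem5 (Δ : Set ℕ) (hΔ : ∀ δ ∈ Δ, 3 ≤ δ) (hne : Δ.Nonempty)
    (p : ℕ) (hp : IsGreatest {d : ℕ | ∀ δ ∈ Δ, d ∣ δ - 2} p) :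
    (∀ t : PlaneTree, t.IsLeafRooted → t.IsValent (Δ ∪ {1}) →
      t.numNonRootLeaves ≡ 1 [MOD p]) ∧
    ∃ τ ρ γ : ℝ,
      PlaneTree.IsTreeConstants Δ τ ρ γ ∧
      (∀ τ' ρ' γ' : ℝ, PlaneTree.IsTreeConstants Δ τ' ρ' γ' → τ' = τ ∧ ρ' = ρ ∧ γ' = γ) ∧
      ∃ ε : ℕ → ℝ, ε =O[Filter.atTop] (fun n : ℕ => 1 / (n : ℝ)) ∧
        ∀ n : ℕ, (PlaneTree.treeCount Δ (n * p + 1) : ℝ) =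
          (p : ℝ) * γ / (2 * √Real.pi) * ((n : ℝ) * (p : ℝ) + 1) ^ (-(3 / 2) : ℝ) *
            ρ ^ (-((n : ℤ) * (p : ℤ) + 1)) * (1 + ε n) := by
  refine ⟨fun t => PlaneTree.numNonRootLeaves_modEq hΔ hp.1 t, ?_⟩
  have hp0 : p ≠ 0 := by
    have : 1 ≤ p := hp.2 fun δ _ => one_dvd _
    omega
  obtain ⟨τ, h0, h1, h⟩ := PlaneTree.exists_realDegreeSeries_eq hΔ hne
  have hT := PlaneTree.isTreeConstants hΔ hne h0 h1 h
  have p1 := PlaneTree.realDegreeSeries_pos hΔ hne 1 h0 h1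
  have p2 := PlaneTree.realDegreeSeries_pos hΔ hne 2 h0 h1
  have hpr : (0 : ℝ) < p := by exact_mod_cast Nat.pos_of_ne_zero hp0
  refine ⟨τ, _, _, hT, fun τ' ρ' γ' h' => hT.unique hΔ hne h', ?_⟩
  have hγ0 := hT.gamma_pos
  have hρ0 := hT.rho_pos
  obtain ⟨b, hb⟩ : ∃ b : ℝ, b = (PlaneTree.realDegreeSeries Δ 2 τ +
    PlaneTree.realDegreeSeries Δ 1 τ) / (p * PlaneTree.realDegreeSeries Δ 1 τ) := ⟨_, rfl⟩
  have hb0 : 0 < b := by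
    rw [hb]
    positivity
  obtain ⟨J, hJ, hJT⟩ := PlaneTree.exists_isBigO_treeCount hΔ hne hp hp0 h0 h1 h hb
  obtain ⟨γ, hγ⟩ : ∃ γ : ℝ, γ = √(2 * (τ * PlaneTree.realDegreeSeries Δ 1 τ) /
    ((PlaneTree.realDegreeSeries Δ 2 τ + PlaneTree.realDegreeSeries Δ 1 τ) / τ)) := ⟨_, rfl⟩
  obtain ⟨ρ, hρ⟩ : ∃ ρ : ℝ, ρ = τ * PlaneTree.realDegreeSeries Δ 1 τ := ⟨_, rfl⟩
  rw [← hγ] at hγ0 ⊢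
  rw [← hρ] at hρ0 ⊢
  -- Here `p b = (S_2 + S_1) / S_1`, so the curvature of the peak determines `γ`.
  have hγb : γ = τ * √(2 / (p * b)) := by
    rw [hγ, hb, ← Real.sqrt_sq h0.le, ← Real.sqrt_mul (by positivity), Real.sqrt_sq h0.le]
    congr 1
    field_simp
  have hpi := Real.pi_pos
  have hspi := Real.sqrt_pos.2 hpi
  have hκ : τ / (√Real.pi * p * γ) * √(2 * Real.pi / b) = 1 / √p := by
    have e : √(2 * Real.pi / b) = √Real.pi * √p * √(2 / (p * b)) := by
      rw [← Real.sqrt_mul hpi.le, ← Real.sqrt_mul (by positivity)]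
      congr 1
      field_simp
    have hs1 : 0 < √(2 / (p * b)) := Real.sqrt_pos.2 (by positivity)
    have hs2 := Real.sqrt_pos.2 hpr
    rw [e, hγb]
    field_simp
    exact Real.sq_sqrt hpr.le
  -- `ε` is found by solving the claimed formula for it, so the formula is exact for every `n`; only
  -- the size of `ε` is asymptotic.
  refine ⟨fun n => τ / (√Real.pi * p * γ) * √((n : ℝ) * p + 1) * J n - 1,
    PlaneTree.relative_error_isBigO hp0 hb0 hJ hκ, fun n => ?_⟩
  have hJn := hJT n
  rw [← hρ] at hJn
  have hn : (0 : ℝ) < (n : ℝ) * p + 1 := by positivity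
  have hz : ρ ^ (-((n : ℤ) * (p : ℤ) + 1)) = (ρ ^ (n * p + 1))⁻¹ := by
    rw [zpow_neg]
    congr 1
  have hr : ((n : ℝ) * p + 1) ^ (-(3 / 2) : ℝ) * √((n : ℝ) * p + 1) = ((n : ℝ) * p + 1)⁻¹ := by
    rw [Real.sqrt_eq_rpow, ← Real.rpow_add hn, ← Real.rpow_neg_one]
    norm_num
  have hsq : √Real.pi ^ 2 = Real.pi := Real.sq_sqrt hpi.le
  rw [hz, add_sub_cancel]
  calc (PlaneTree.treeCount Δ (n * p + 1) : ℝ) =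
      (2 * Real.pi * ρ ^ (n * p + 1) * ((n * p + 1) * PlaneTree.treeCount Δ (n * p + 1))) /
        (2 * Real.pi) * ((n : ℝ) * p + 1)⁻¹ * (ρ ^ (n * p + 1))⁻¹ := by field_simp
    _ = (J n * τ) / (2 * √Real.pi ^ 2) * (((n : ℝ) * p + 1) ^ (-(3 / 2) : ℝ) *
        √((n : ℝ) * p + 1)) * (ρ ^ (n * p + 1))⁻¹ := by rw [hJn, hr, hsq]
    _ = _ := by field_simp
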